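/- **Setting.** Let $T=\mathrm{conv}(x_1,x_2,x_3,x_4)\subset\mathbb R^3$ be a non-degenerate tetrahedron (its four vertices are affinely independent), with barycentric coordinates $\lambda_1,\dots,\lambda_4$, so that $x=\sum_k\lambda_k x_k$ and $\sum_k\lambda_k=1$. For $\alpha\in\mathbb Z_{\ge0}^4$ write $|\alpha|=\sum_k\alpha_k$ and $\alpha!=\prod_k\alpha_k!$; let $e_\ell$ be the $\ell$-th unit multi-index, and let $B^n_\alpha=\frac{n!}{\alpha!}\lambda^\alpha$ for $|\alpha|=n$ be the Bernstein polynomials. Let $\mathbb P_n$ be the space of polynomial functions on $T$ of degree at most $n$ and $\widetilde{\mathbb P}_n$ the space of homogeneous polynomial functions of degree $n$ in the Cartesian coordinates. **Basis functions.** - Whitney edge forms: $\omega_{ij}=\lambda_i\nabla\lambda_j-\lambda_j\nabla\lambda_i$. - Face bubbles: for a face $F=\mathrm{conv}(x_{i_1},x_{i_2},x_{i_3})$ of $T$, with an arbitrary fixed enumeration of its vertices, and $i_4$ the remaining index, let $\tilde{\mathcal I}^n(F)=\{\alpha:|\alpha|=n,\ \alpha_{i_4}=0\}$ and, for $\alpha\in\tilde{\mathcal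 I}^n(F)$, $$\Phi^{FT,n}_\alpha=(n+1)B^n_\alpha\,(\alpha_{i_1}\omega_{i_2i_3}+\alpha_{i_2}\omega_{i_3i_1}+\alpha_{i_3}\omega_{i_1i_2}).$$ Let $\tilde{\mathcal I}^n(F)'$ be $\tilde{\mathcal I}^n(F)$ with a single, arbitrary index removed (chosen independently for each face). - Cell bubbles: let $\mathring{\mathcal I}^{n}=\{\alpha:|\alpha|=n,\ \alpha_k>0\text{ for all }k\}$ and, for $\alpha\in\mathring{\mathcal I}^{n+1}$ and $\ell\in\{1,2,3,4\}$, $$\Psi^{n}_{\ell,\alpha}=(n+1)B^n_{\alpha-e_\ell}\nabla\lambda_\ell-\frac{\alpha_\ell}{n+1}\nabla B^{n+1}_\alpha .$$ - Non-vertex indices: $\check{\mathcal I}^{n}=\{\alpha:|\alpha|=n\}\setminus\{n e_\ell:1\le\ell\le4\}$. **Theorem.** 1. For every $n\ge0$ the sum $\mathbb P_n^3\oplus x\times\widetilde{\mathbb P}_n^3$ is direct, and the fields $$\omega_{ij}\ (1\le i<j\le4),\qquad \nabla B^{n+1}_\alpha\ (\alpha\in\check{\mathcal I}^{n+1}),\qquad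 \Phi^{FT,n}_\alpha\ (F\text{ a face of }T,\ \alpha\in\tilde{\mathcal I}^n(F)'),$$ $$\Psi^{n+1}_{\ell,\alpha}\ (\ell=1,2,\ \alpha\in\mathring{\mathcal I}^{n+2}),\qquad \Psi^{n+1}_{3,\alpha}\ (\alpha\in\mathring{\mathcal I}^{n+2},\ \alpha_3=1)$$ form a basis of it (without repetitions). 2. For every $n\ge1$ the fields $$\omega_{ij}\ (1\le i<j\le4),\qquad \nabla B^{n+1}_\alpha\ (\alpha\in\check{\mathcal I}^{n+1}),\qquad \Phi^{FT,n-1}_\alpha\ (F\text{ a face of }T,\ \alpha\in\tilde{\mathcal I}^{n-1}(F)'),$$ $$\Psi^{n}_{\ell,\alpha}\ (\ell=1,2,\ \alpha\in\mathring{\mathcal I}^{n+1}),\qquad \Psi^{n}_{3,\alpha}\ (\alpha\in\mathring{\mathcal I}^{n+1},\ \alpha_3=1)$$ form a basis of $\mathbb P_n^3$ (without repetitions). -/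

import Mathlib

noncomputable section

namespace BernsteinCurl

/-- Points and vectors of three-dimensional space, in Cartesian coordinates. -/
abbrev R3 : Type := Fin 3 → ℝ

/-- Multi-indices with four entries. The vertices are numbered `0, 1, 2, 3`
(instead of `1, 2, 3, 4`). -/
abbrev MultiIndex : Type := Fin 4 → ℕ

/-! ### Tetrahedron, barycentric coordinates, gradient -/

/-- The tetrahedron `conv(x₀, x₁, x₂, x₃)`. -/
def tetra (x : Fin 4 → R3) : Set R3 := convexHull ℝ (Set.range x)

/-- Four affinely independent points form an affine basis of space. -/
def vertexBasis (x : Fin 4 → R3) (hx : AffineIndependent ℝ x) : AffineBasis (Fin 4) ℝ R3 where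
  toFun := x
  ind' := hx
  tot' := by
    rw [hx.affineSpan_eq_top_iff_card_eq_finrank_add_one]
    simp

/-- The barycentric coordinate `λ_i` with respect to the tetrahedron with vertices `x`. -/
def bary (x : Fin 4 → R3) (hx : AffineIndependent ℝ x) (i : Fin 4) (y : R3) : ℝ :=
  (vertexBasis x hx).coord i y

/-- The barycentric coordinates reproduce the point and sum to one. -/
theorem bary_spec (x : Fin 4 → R3) (hx : AffineIndependent ℝ x) (y : R3) :
    y = ∑ k, bary x hx k y • x k ∧ ∑ k, bary x hx k y = 1 :=
  ⟨((vertexBasis x hx).linear_combination_coord_eq_self y).symm,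
    (vertexBasis x hx).sum_coord_apply_eq_one y⟩

/-- The gradient: the vector of the partial derivatives. -/
def grad (f : R3 → ℝ) (y : R3) : R3 := fun j => fderiv ℝ f y (Pi.single j 1)

/-! ### Index sets -/

/-- All multi-indices `α` with `|α| = n`. -/
def indexSet (n : ℕ) : Set MultiIndex := {α | ∑ k, α k = n}

/-- The non-vertex multi-indices: `|α| = n`, and `α` is none of the `n e_ℓ`. -/
def nonVertexIndexSet (n : ℕ) : Set MultiIndex :=
  {α | α ∈ indexSet n ∧ ∀ l : Fin 4, α ≠ n • Pi.single l 1}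

/-- The multi-indices on the face opposite to the vertex `m`: `|α| = n` and `α_m = 0`. -/
def faceIndexSet (m : Fin 4) (n : ℕ) : Set MultiIndex :=
  {α | α ∈ indexSet n ∧ α m = 0}

/-- The interior multi-indices: `|α| = n` and all entries positive. -/
def interiorIndexSet (n : ℕ) : Set MultiIndex :=
  {α | α ∈ indexSet n ∧ ∀ k, 0 < α k}

/-! ### Polynomial spaces on a set `K` -/

/-- The polynomial function on `K` given by a polynomial in the Cartesian coordinates. -/
def polyEval (K : Set R3) : MvPolynomial (Fin 3) ℝ →ₗ[ℝ] (K → ℝ) where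
  toFun p := fun y => MvPolynomial.eval (y : R3) p
  map_add' p q := by ext y; simp
  map_smul' c p := by ext y; simp

/-- Polynomial functions on `K` of total degree at most `n`. -/
def polySpace (K : Set R3) (n : ℕ) : Submodule ℝ (K → ℝ) :=
  (MvPolynomial.restrictTotalDegree (Fin 3) ℝ n).map (polyEval K)

/-- Homogeneous polynomial functions on `K` of degree `n`. -/
def homPolySpace (K : Set R3) (n : ℕ) : Submodule ℝ (K → ℝ) :=
  (MvPolynomial.homogeneousSubmodule (Fin 3) ℝ n).map (polyEval K)

/-- `S³`: the vector fields on `K` all of whose three components lie in `S`. -/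
def cube {K : Set R3} (S : Submodule ℝ (K → ℝ)) : Submodule ℝ (K → R3) where
  carrier := {v | ∀ j : Fin 3, (fun y => v y j) ∈ S}
  add_mem' hu hv j := S.add_mem (hu j) (hv j)
  zero_mem' _ := S.zero_mem
  smul_mem' c _ hv j := S.smul_mem c (hv j)

/-- The map taking the field `v` to the field `y ↦ y × v(y)`. -/
def crossPosition (K : Set R3) : (K → R3) →ₗ[ℝ] (K → R3) where
  toFun v := fun y => crossProduct (y : R3) (v y)
  map_add' u v := by ext y : 1; simp
  map_smul' c v := by ext y : 1; simp

/-- The second-kind space: vector fields with components of degree at most `n`. -/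
def nedelecTwo (K : Set R3) (n : ℕ) : Submodule ℝ (K → R3) := cube (polySpace K n)

/-- The fields `x × q` with `q` a homogeneous polynomial vector field of degree `n`. -/
def crossHom (K : Set R3) (n : ℕ) : Submodule ℝ (K → R3) :=
  (cube (homPolySpace K n)).map (crossPosition K)

/-- The first-kind space, the sum of `nedelecTwo K n` and `crossHom K n`. -/
def nedelecOne (K : Set R3) (n : ℕ) : Submodule ℝ (K → R3) := nedelecTwo K n ⊔ crossHom K n

/-! ### The basis functions, as fields on the whole space -/

section Functions

variable (x : Fin 4 → R3) (hx : AffineIndependent ℝ x)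

/-- The Bernstein polynomial `B^n_α = (n! / α!) λ^α`, used for `|α| = n`. -/
def bernstein (n : ℕ) (α : MultiIndex) (y : R3) : ℝ :=
  (n.factorial : ℝ) / (∏ k, ((α k).factorial : ℝ)) * ∏ k, bary x hx k y ^ α k

/-- The Whitney edge form `ω_ij = λ_i ∇λ_j - λ_j ∇λ_i`. -/
def whitney (i j : Fin 4) (y : R3) : R3 :=
  bary x hx i y • grad (bary x hx j) y - bary x hx j y • grad (bary x hx i) y

/-- The lifted face bubble
`(n+1) B^n_α (α_{i₁} ω_{i₂ i₃} + α_{i₂} ω_{i₃ i₁} + α_{i₃} ω_{i₁ i₂})`, for the face with vertices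
`i₁ = s 0`, `i₂ = s 1`, `i₃ = s 2`; the vertex opposite to the face is `s 3`. -/
def faceBubble (s : Equiv.Perm (Fin 4)) (n : ℕ) (α : MultiIndex) (y : R3) : R3 :=
  (((n : ℝ) + 1) * bernstein x hx n α y) •
    ((α (s 0) : ℝ) • whitney x hx (s 1) (s 2) y + (α (s 1) : ℝ) • whitney x hx (s 2) (s 0) y
      + (α (s 2) : ℝ) • whitney x hx (s 0) (s 1) y)

/-- The cell bubble
`Ψ^n_{ℓ,α} = (n+1) B^n_{α - e_ℓ} ∇λ_ℓ - (α_ℓ / (n+1)) ∇B^{n+1}_α`,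
used for `|α| = n+1` with all entries of `α` positive. -/
def cellBubble (n : ℕ) (l : Fin 4) (α : MultiIndex) (y : R3) : R3 :=
  (((n : ℝ) + 1) * bernstein x hx n (α - Pi.single l 1) y) • grad (bary x hx l) y
    - ((α l : ℝ) / ((n : ℝ) + 1)) • grad (bernstein x hx (n + 1) α) y

end Functions

/-! ### The basis as one indexed family -/

/-- Pairs `i < j`. -/
abbrev EdgeIndex : Type := {p : Fin 4 × Fin 4 // p.1 < p.2}

/-- The indices of the face bubbles of degree `k`: a face, named by its opposite vertex `m`, and a
multi-index on that face other than the removed multi-index `r m`. -/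
abbrev FaceBubbleIndex (k : ℕ) (r : Fin 4 → MultiIndex) : Type :=
  Σ m : Fin 4, {α : MultiIndex // α ∈ faceIndexSet m k ∧ α ≠ r m}

/-- The indices of the cell bubbles with `|α| = N`: the pairs `(ℓ, α)` with `α` interior and `ℓ`
the first or the second vertex, or `ℓ` the third vertex and the third entry of `α` equal to `1`. -/
abbrev CellBubbleIndex (N : ℕ) : Type :=
  {p : Fin 4 × MultiIndex //
    p.2 ∈ interiorIndexSet N ∧ (p.1 = 0 ∨ p.1 = 1 ∨ (p.1 = 2 ∧ p.2 2 = 1))}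

/-- The index type of all the basis functions: edges, gradients, face bubbles, cell bubbles. -/
abbrev CurlIndex (n k : ℕ) (r : Fin 4 → MultiIndex) : Type :=
  EdgeIndex ⊕ nonVertexIndexSet (n + 1) ⊕ FaceBubbleIndex k r ⊕ CellBubbleIndex (k + 2)

/-- The fields on the tetrahedron: Whitney forms, gradients of the non-vertex Bernstein polynomials
of degree `n + 1`, face bubbles of degree `k`, cell bubbles `Ψ^{k+1}_{ℓ,α}`. The vertices of the
face opposite to `m` are enumerated by `σ m`, and the multi-index `r m` is left out on that face. -/
def curlFamily (x : Fin 4 → R3) (hx : AffineIndependent ℝ x) (σ : Fin 4 → Equiv.Perm (Fin 4))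
    (n k : ℕ) (r : Fin 4 → MultiIndex) : CurlIndex n k r → (tetra x → R3)
  | .inl e => fun y => whitney x hx e.1.1 e.1.2 y
  | .inr (.inl α) => fun y => grad (bernstein x hx (n + 1) α.1) y
  | .inr (.inr (.inl f)) => fun y => faceBubble x hx (σ f.1) k f.2.1 y
  | .inr (.inr (.inr c)) => fun y => cellBubble x hx (k + 1) c.1.1 c.1.2 y

/-- The family `v` is a basis of the subspace `S`: it is linearly independent (in particular
without repetitions) and its span is `S`. -/
def IsBasisOf {ι V : Type*} [AddCommGroup V] [Module ℝ V] (v : ι → V) (S : Submodule ℝ V) : Prop :=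
  LinearIndependent ℝ v ∧ Submodule.span ℝ (Set.range v) = S

end BernsteinCurl

end

noncomputable section

namespace BernsteinCurl

/-! Every field in the family of degree `n ≥ 1` can be written `∑ C_{β,l} B^n_β ∇λ_l`. Since the
`B^n_β` are independent and the only relation among the `∇λ_l` is `∑ ∇λ_l = 0`, such a field
vanishes exactly when `C_{β,l}` does not depend on `l`. Independence in the second-kind case thus
becomes a combinatorial statement about arrays (`coefficients_eq_zero`), proved by increasing
dimension of the support of `β`.

On an edge, the gradient coefficients form an arithmetic progression whose step is a multiple of the
Whitney coefficient; the vertex indices are left out, so both ends are zero and everything vanishes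
(`edge_step`). On a face, adding three cyclically arranged equations eliminates the gradients and
leaves a discrete mean value property for the bubble coefficients. By the maximum principle these
are constant, and the index removed from the face makes the constant zero (`eq_zero_of_mean_value`,
`face_step`). In the interior, mass is moved from entry `3` to entry `2` until the boundary is
reached; the restriction `α 2 = 1` on the third kind of cell bubble is what permits this
(`interior_step`). The number of fields is at least `3 dim P_n`, an upper bound for the dimension of
`P_n³`, so they also span (`isBasisOf_nedelecTwo`).

The first-kind family in degree `n` is the second-kind family in degree `n + 1` with the gradients
of degree-`n + 2` potentials replaced by those of degree-`n + 1` potentials, whose span is smaller;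
independence is inherited. For spanning, expand a first-kind field in the larger basis. Whitney
forms and bubbles are themselves of the first kind, so the remaining part `∇p` is too. As `x · (x ×
q) = 0`, the function `x · ∇p` has degree at most `n + 1`, and Euler's identity gives `deg p ≤ n +
1` (`mem_span_gradFamily_of_mem_nedelecOne`). No dimension formula for the first-kind space is
needed. -/

variable {x : Fin 4 → R3} (hx : AffineIndependent ℝ x)

/-! ### Barycentric coordinates and their gradients -/

/-- The derivative of the barycentric coordinate `λ_l`. -/
def baryDeriv (hx : AffineIndependent ℝ x) (l : Fin 4) : R3 →L[ℝ] ℝ :=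
  LinearMap.toContinuousLinearMap ((vertexBasis x hx).coord l).linear

/-- The constant gradient of `λ_l`. -/
def baryGrad (hx : AffineIndependent ℝ x) (l : Fin 4) : R3 :=
  fun j => baryDeriv hx l (Pi.single j 1)

theorem bary_eq (l : Fin 4) (y : R3) : bary x hx l y = baryDeriv hx l y + bary x hx l 0 := by
  have h := congrFun (AffineMap.decomp ((vertexBasis x hx).coord l)) y
  simpa [bary, baryDeriv] using h

theorem hasFDerivAt_bary (l : Fin 4) (y : R3) :
    HasFDerivAt (bary x hx l) (baryDeriv hx l) y := by
  have h : bary x hx l = fun y => baryDeriv hx l y + bary x hx l 0 := funext (bary_eq hx l)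
  rw [h]
  exact (baryDeriv hx l).hasFDerivAt.add_const _

theorem grad_bary (l : Fin 4) (y : R3) : grad (bary x hx l) y = baryGrad hx l := by
  ext j
  simp [grad, baryGrad, (hasFDerivAt_bary hx l y).fderiv]

theorem baryDeriv_eq_dotProduct (l : Fin 4) (v : R3) :
    baryDeriv hx l v = ∑ j, baryGrad hx l j * v j := by
  conv_lhs => rw [pi_eq_sum_univ' v]
  simp [baryGrad, map_sum, map_smul, mul_comm]

theorem bary_vertex (l i : Fin 4) : bary x hx l (x i) = if l = i then 1 else 0 :=
  (vertexBasis x hx).coord_apply l i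

theorem baryDeriv_edge (l i j : Fin 4) :
    baryDeriv hx l (x i - x j) = (if l = i then 1 else 0) - (if l = j then 1 else 0) := by
  rw [← bary_vertex hx, ← bary_vertex hx, bary_eq hx l (x i), bary_eq hx l (x j), map_sub]
  ring

theorem sum_bary (y : R3) : ∑ k, bary x hx k y = 1 := (bary_spec x hx y).2

theorem sum_bary_smul (y : R3) : ∑ k, bary x hx k y • x k = y := (bary_spec x hx y).1.symm

theorem sum_baryDeriv (v : R3) : ∑ l, baryDeriv hx l v = 0 := by
  have h1 := sum_bary hx v
  have h2 := sum_bary hx 0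
  simp only [bary_eq hx _ v, Finset.sum_add_distrib] at h1
  linarith

theorem sum_baryDeriv_smul (v : R3) : ∑ l, baryDeriv hx l v • x l = v := by
  have h1 := sum_bary_smul hx v
  have h2 := sum_bary_smul hx 0
  simp only [bary_eq hx _ v, add_smul, Finset.sum_add_distrib] at h1
  rw [h2, add_zero] at h1
  exact h1

/-- The only linear relation among the gradients of the barycentric coordinates is that their sum
is zero. -/
theorem eq_of_sum_smul_baryGrad_eq_zero {p : Fin 4 → ℝ} (h : ∑ l, p l • baryGrad hx l = 0)
    (i j : Fin 4) : p i = p j := by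
  -- Pairing the relation with the edge vector `x i - x j` isolates `p i - p j`.
  have h1 : ∑ l, p l * baryDeriv hx l (x i - x j) = 0 := by
    simp only [baryDeriv_eq_dotProduct, Finset.mul_sum]
    rw [Finset.sum_comm]
    refine Finset.sum_eq_zero fun k _ => ?_
    have := congrFun h k
    simp only [Finset.sum_apply, Pi.smul_apply, smul_eq_mul, Pi.zero_apply] at this
    simp only [← mul_assoc, ← Finset.sum_mul, this, zero_mul]
  simp only [baryDeriv_edge, mul_sub, Finset.sum_sub_distrib] at h1
  simp at h1
  linarith

/-- A vector is recovered from its components along the edges at a vertex. -/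
theorem sum_dotProduct_edge_smul_baryGrad (v : R3) :
    ∑ l, (∑ k, v k * (x l k - x 3 k)) • baryGrad hx l = v := by
  ext j
  have h1 := sum_baryDeriv_smul hx (Pi.single j 1)
  have h2 := sum_baryDeriv hx (Pi.single j 1)
  -- The identity matrix is `∑ x_l ⊗ ∇λ_l`; subtracting `x 3` is harmless because the gradients sum
  -- to zero.
  have h3 : ∀ k, ∑ l, baryGrad hx l j * (x l k - x 3 k) = (Pi.single j 1 : R3) k := by
    intro k
    rw [← congrFun h1 k]
    simp only [mul_sub, Finset.sum_sub_distrib, ← Finset.sum_mul]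
    simp [baryGrad, h2]
  simp only [Finset.sum_apply, Pi.smul_apply, smul_eq_mul, Finset.sum_mul]
  rw [Finset.sum_comm]
  have h4 : ∀ k, ∑ l, v k * (x l k - x 3 k) * baryGrad hx l j = v k * (Pi.single j 1 : R3) k := by
    intro k
    rw [← h3 k, Finset.mul_sum]
    exact Finset.sum_congr rfl fun l _ => by ring
  simp only [h4]
  simp [Pi.single_apply]

/-! ### Bernstein polynomials -/

/-- The multi-indices `α` with `|α| = n` as a finite set. -/
def indexFinset (n : ℕ) : Finset MultiIndex := Finset.piAntidiag Finset.univ n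

theorem mem_indexFinset {n : ℕ} {α : MultiIndex} : α ∈ indexFinset n ↔ α ∈ indexSet n := by
  simp [indexFinset, indexSet]

/-- The `l`-th unit multi-index. -/
abbrev unitIndex (l : Fin 4) : MultiIndex := Pi.single l 1

theorem add_unitIndex_mem {n : ℕ} {α : MultiIndex} (l : Fin 4) :
    α + unitIndex l ∈ indexSet (n + 1) ↔ α ∈ indexSet n := by
  simp [indexSet, Finset.sum_add_distrib]

theorem exists_eq_add_unitIndex {α : MultiIndex} {l : Fin 4} (h : α l ≠ 0) :
    ∃ β, α = β + unitIndex l := by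
  refine ⟨α - unitIndex l, ?_⟩
  ext k
  by_cases hk : k = l
  · subst hk; simp; omega
  · simp [hk]

theorem factorial_add_unitIndex (α : MultiIndex) (l : Fin 4) :
    (∏ k, (((α + unitIndex l) k).factorial : ℝ)) =
      ((α l : ℝ) + 1) * ∏ k, ((α k).factorial : ℝ) := by
  rw [← Finset.mul_prod_erase _ _ (Finset.mem_univ l),
    ← Finset.mul_prod_erase Finset.univ (fun k => ((α k).factorial : ℝ)) (Finset.mem_univ l)]
  have : ∏ k ∈ Finset.univ.erase l, (((α + unitIndex l) k).factorial : ℝ) =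
      ∏ k ∈ Finset.univ.erase l, ((α k).factorial : ℝ) := by
    refine Finset.prod_congr rfl fun k hk => ?_
    simp [Finset.ne_of_mem_erase hk]
  rw [this]
  simp [Nat.factorial_succ]
  ring

theorem prod_pow_add_unitIndex (t : Fin 4 → ℝ) (α : MultiIndex) (l : Fin 4) :
    (∏ k, t k ^ (α + unitIndex l) k) = t l * ∏ k, t k ^ α k := by
  simp only [Pi.add_apply, pow_add, Finset.prod_mul_distrib]
  rw [Finset.prod_eq_single (f := fun k => t k ^ unitIndex l k) l]
  · simp [mul_comm]
  · intro k _ hk; simp [hk]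
  · simp

theorem prod_factorial_ne_zero (α : MultiIndex) : (∏ k, ((α k).factorial : ℝ)) ≠ 0 :=
  Finset.prod_ne_zero_iff.2 fun k _ => by exact_mod_cast (α k).factorial_ne_zero

/-- Degree raising: the identity from which the coefficient arrays of Whitney forms and face
bubbles, and the Whitney expansion of cell bubbles, are obtained. -/
theorem bary_mul_bernstein (n : ℕ) (α : MultiIndex) (l : Fin 4) (y : R3) :
    ((n : ℝ) + 1) * bernstein x hx n α y * bary x hx l y =
      ((α l : ℝ) + 1) * bernstein x hx (n + 1) (α + unitIndex l) y := by
  unfold bernstein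
  rw [factorial_add_unitIndex, prod_pow_add_unitIndex, Nat.factorial_succ]
  have h1 := prod_factorial_ne_zero α
  have h2 : (α l : ℝ) + 1 ≠ 0 := by positivity
  push_cast
  field_simp

theorem sum_bernstein (n : ℕ) (y : R3) : ∑ β ∈ indexFinset n, bernstein x hx n β y = 1 := by
  have h := Finset.sum_pow_eq_sum_piAntidiag Finset.univ (fun k => bary x hx k y) n
  rw [sum_bary, one_pow] at h
  rw [h]
  refine Finset.sum_congr rfl fun β hβ => ?_
  unfold bernstein
  congr 1
  have hs : ∑ k, β k = n := mem_indexFinset.1 hβ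
  have h2 := Nat.multinomial_spec Finset.univ β
  rw [hs] at h2
  rw [div_eq_iff (prod_factorial_ne_zero β), ← h2]
  push_cast
  ring

/-- A sum over `|β| = n` that only sees the `β` with `α = β + e_l`. -/
theorem sum_ite_eq_add_unitIndex {n : ℕ} {β : MultiIndex} (hβ : β ∈ indexSet n) (l : Fin 4)
    (c : MultiIndex → ℝ) :
    (∑ γ ∈ indexFinset n, if β + unitIndex l = γ + unitIndex l then c γ else 0) = c β := by
  simp only [add_left_inj]
  rw [Finset.sum_ite_eq, if_pos (mem_indexFinset.2 hβ)]

theorem ne_add_unitIndex {α : MultiIndex} {l : Fin 4} (h : α l = 0) (γ : MultiIndex) :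
    α ≠ γ + unitIndex l := by
  rintro rfl
  simp at h

/-- The field `∑_{β,l} C_{β,l} B^n_β ∇λ_l` with coefficient array `C`. -/
def arrayField (hx : AffineIndependent ℝ x) (n : ℕ) :
    (MultiIndex → Fin 4 → ℝ) →ₗ[ℝ] (R3 → R3) where
  toFun C := fun y => ∑ l, (∑ β ∈ indexFinset n, C β l * bernstein x hx n β y) • baryGrad hx l
  map_add' C D := by
    ext1 y
    simp [add_mul, Finset.sum_add_distrib, add_smul]
  map_smul' a C := by
    ext1 y
    simp [mul_assoc, ← Finset.mul_sum, mul_smul, Finset.smul_sum]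

theorem arrayField_apply (n : ℕ) (C : MultiIndex → Fin 4 → ℝ) (y : R3) :
    arrayField hx n C y =
      ∑ l, (∑ β ∈ indexFinset n, C β l * bernstein x hx n β y) • baryGrad hx l := rfl

theorem hasFDerivAt_bernstein (n : ℕ) (α : MultiIndex) (y : R3) :
    HasFDerivAt (bernstein x hx n α)
      (((n.factorial : ℝ) / (∏ k, ((α k).factorial : ℝ))) •
        ∑ l, (∏ k ∈ Finset.univ.erase l, bary x hx k y ^ α k) •
          ((α l • bary x hx l y ^ (α l - 1)) • baryDeriv hx l)) y := by
  have := HasFDerivAt.finsetProd (u := Finset.univ)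
    (fun l _ => (hasFDerivAt_bary hx l y).pow (α l))
  exact this.const_mul _

/-- The gradient of a Bernstein polynomial as a coefficient array. -/
theorem grad_bernstein {n : ℕ} {α : MultiIndex} (hα : α ∈ indexSet (n + 1)) :
    grad (bernstein x hx (n + 1) α) =
      arrayField hx n fun β l => if α = β + unitIndex l then (n : ℝ) + 1 else 0 := by
  ext y j
  rw [grad, (hasFDerivAt_bernstein hx (n + 1) α y).fderiv, arrayField_apply]
  simp only [smul_apply, sum_apply, Finset.sum_apply,
    smul_eq_mul, Finset.mul_sum, Pi.smul_apply]
  refine Finset.sum_congr rfl fun l _ => ?_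
  change _ = _ * baryDeriv hx l (Pi.single j 1)
  by_cases hl : α l = 0
  · simp [hl, ne_add_unitIndex hl]
  · obtain ⟨β, rfl⟩ := exists_eq_add_unitIndex hl
    have hβ := (add_unitIndex_mem l).1 hα
    simp only [ite_mul, zero_mul]
    rw [sum_ite_eq_add_unitIndex hβ l, bernstein, factorial_add_unitIndex, Nat.factorial_succ]
    have h1 : ∏ k, bary x hx k y ^ β k = bary x hx l y ^ β l *
        ∏ k ∈ Finset.univ.erase l, bary x hx k y ^ (β + unitIndex l) k := by
      rw [← Finset.mul_prod_erase _ _ (Finset.mem_univ l)]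
      congr 1
      refine Finset.prod_congr rfl fun k hk => ?_
      simp [Finset.ne_of_mem_erase hk]
    rw [h1]
    have h2 := prod_factorial_ne_zero β
    have h3 : (β l : ℝ) + 1 ≠ 0 := by positivity
    simp
    field_simp

/-! ### Coefficient arrays of the basis functions -/

/-- The coefficient array of `ω_ij` in degree `n`. -/
def whitneyArray (n : ℕ) (i j : Fin 4) (β : MultiIndex) (l : Fin 4) : ℝ :=
  (if l = j then (β i : ℝ) / n else 0) - (if l = i then (β j : ℝ) / n else 0)

/-- The coefficient array of `∇B^{n+1}_α` in degree `n`. -/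
def gradArray (n : ℕ) (α β : MultiIndex) (l : Fin 4) : ℝ :=
  if α = β + unitIndex l then (n : ℝ) + 1 else 0

/-- The coefficient array of the face bubble with index `α` in degree `|α| + 1`. -/
def faceArray (s : Equiv.Perm (Fin 4)) (α β : MultiIndex) (l : Fin 4) : ℝ :=
  (if l = s 0 then (β (s 1) * β (s 2) : ℝ) *
    ((if β = α + unitIndex (s 2) then 1 else 0) - if β = α + unitIndex (s 1) then 1 else 0)
    else 0) +
  (if l = s 1 then (β (s 2) * β (s 0) : ℝ) *
    ((if β = α + unitIndex (s 0) then 1 else 0) - if β = α + unitIndex (s 2) then 1 else 0)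
    else 0) +
  (if l = s 2 then (β (s 0) * β (s 1) : ℝ) *
    ((if β = α + unitIndex (s 1) then 1 else 0) - if β = α + unitIndex (s 0) then 1 else 0)
    else 0)

/-- The coefficient array of `Ψ^n_{l₀,α}`. -/
def cellArray (n : ℕ) (l₀ : Fin 4) (α β : MultiIndex) (l : Fin 4) : ℝ :=
  if α = β + unitIndex l then (if l = l₀ then (n : ℝ) + 1 else 0) - α l₀ else 0

/-- Multiply the partition of unity of degree `n - 1` by `λ_i` and raise the degree. Indices with `β
i = 0` are not reached by `γ ↦ γ + e_i`, but their weight is zero. -/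
theorem sum_index_mul_bernstein {n : ℕ} (hn : n ≠ 0) (i : Fin 4) (y : R3) :
    ∑ β ∈ indexFinset n, (β i : ℝ) / n * bernstein x hx n β y = bary x hx i y := by
  obtain ⟨k, rfl⟩ := Nat.exists_eq_succ_of_ne_zero hn
  have h1 : bary x hx i y = ∑ γ ∈ indexFinset k,
      ((γ i : ℝ) + 1) / ((k : ℝ) + 1) * bernstein x hx (k + 1) (γ + unitIndex i) y := by
    have hk : (k : ℝ) + 1 ≠ 0 := by positivity
    have h : bary x hx i y = (∑ γ ∈ indexFinset k, bernstein x hx k γ y) * bary x hx i y := by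
      rw [sum_bernstein, one_mul]
    rw [h, Finset.sum_mul]
    refine Finset.sum_congr rfl fun γ _ => ?_
    have := bary_mul_bernstein hx k γ i y
    field_simp
    linarith
  rw [h1]
  symm
  refine Finset.sum_bij_ne_zero (fun γ _ _ => γ + unitIndex i) ?_ ?_ ?_ ?_
  · intro γ hγ _
    exact mem_indexFinset.2 ((add_unitIndex_mem i).2 (mem_indexFinset.1 hγ))
  · intro γ _ _ γ' _ _ h
    exact add_right_cancel h
  · intro β hβ h
    have hi : β i ≠ 0 := by
      rintro h0
      simp [h0] at h
    obtain ⟨γ, rfl⟩ := exists_eq_add_unitIndex hi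
    refine ⟨γ, mem_indexFinset.2 ((add_unitIndex_mem i).1 (mem_indexFinset.1 hβ)), ?_, rfl⟩
    simpa using h
  · intro γ _ _
    simp

theorem whitney_eq_arrayField {n : ℕ} (hn : n ≠ 0) (i j : Fin 4) :
    whitney x hx i j = arrayField hx n (whitneyArray n i j) := by
  ext1 y
  rw [arrayField_apply, whitney, grad_bary, grad_bary]
  simp only [whitneyArray, sub_mul, Finset.sum_sub_distrib, ite_mul, zero_mul, sub_smul]
  have h : ∀ a b : Fin 4, ∑ l, (∑ β ∈ indexFinset n,
      if l = a then (β b : ℝ) / n * bernstein x hx n β y else 0) • baryGrad hx l =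
      bary x hx b y • baryGrad hx a := by
    intro a b
    rw [Finset.sum_eq_single a]
    · simp [sum_index_mul_bernstein hx hn]
    · intro l _ hl; simp [hl]
    · simp
  rw [h, h]

theorem sum_ite_eq_bernstein {k : ℕ} {α : MultiIndex} (hα : α ∈ indexSet k) (i : Fin 4)
    (c : MultiIndex → ℝ) (y : R3) :
    ∑ β ∈ indexFinset (k + 1),
      c β * (if β = α + unitIndex i then 1 else 0) * bernstein x hx (k + 1) β y =
      c (α + unitIndex i) * bernstein x hx (k + 1) (α + unitIndex i) y := by
  rw [Finset.sum_eq_single (α + unitIndex i)]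
  · simp
  · intro β _ h; simp [h]
  · intro h
    exact absurd (mem_indexFinset.2 ((add_unitIndex_mem i).2 hα)) h

theorem sum_ite_smul_baryGrad (n : ℕ) (a : Fin 4) (c : MultiIndex → ℝ) (y : R3) :
    ∑ l, (∑ β ∈ indexFinset n, (if l = a then c β else 0) * bernstein x hx n β y) •
      baryGrad hx l = (∑ β ∈ indexFinset n, c β * bernstein x hx n β y) • baryGrad hx a := by
  rw [Finset.sum_eq_single a]
  · simp
  · intro l _ hl; simp [hl]
  · simp

/-- The symmetric prefactors in `faceArray` work because at `β = α + e_j` the product `β_i β_j`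
equals `α_i (α_j + 1)`: the weight from the bubble times the factor from degree raising. -/
theorem faceBubble_eq_arrayField {k : ℕ} {α : MultiIndex} (hα : α ∈ indexSet k)
    (s : Equiv.Perm (Fin 4)) :
    faceBubble x hx s k α = arrayField hx (k + 1) (faceArray s α) := by
  ext1 y
  rw [arrayField_apply]
  simp only [faceArray, add_mul, Finset.sum_add_distrib, add_smul]
  rw [sum_ite_smul_baryGrad, sum_ite_smul_baryGrad, sum_ite_smul_baryGrad]
  simp only [mul_sub, sub_mul, Finset.sum_sub_distrib]
  simp only [sum_ite_eq_bernstein hx hα]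
  have h01 : s 0 ≠ s 1 := by simp
  have h02 : s 0 ≠ s 2 := by simp
  have h12 : s 1 ≠ s 2 := by simp
  simp only [faceBubble, whitney, grad_bary]
  have e : ∀ i j : Fin 4, i ≠ j → ((α + unitIndex i) j : ℝ) = α j := by
    intro i j h; simp [h.symm]
  have e' : ∀ i : Fin 4, ((α + unitIndex i) i : ℝ) = α i + 1 := by
    intro i; simp
  rw [e _ _ h01, e _ _ h02, e _ _ h12, e _ _ h01.symm, e _ _ h02.symm, e _ _ h12.symm, e', e', e']
  have b0 := bary_mul_bernstein hx k α (s 0) y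
  have b1 := bary_mul_bernstein hx k α (s 1) y
  have b2 := bary_mul_bernstein hx k α (s 2) y
  ext j
  simp only [Pi.add_apply, Pi.smul_apply, Pi.sub_apply, smul_eq_mul]
  linear_combination
    (α (s 0) * baryGrad hx (s 2) j - α (s 2) * baryGrad hx (s 0) j) * b1 +
    (α (s 1) * baryGrad hx (s 0) j - α (s 0) * baryGrad hx (s 1) j) * b2 +
    (α (s 2) * baryGrad hx (s 1) j - α (s 1) * baryGrad hx (s 2) j) * b0

theorem cellBubble_eq_arrayField {n : ℕ} {l₀ : Fin 4} {α : MultiIndex}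
    (hα : α ∈ indexSet (n + 1)) (hl : α l₀ ≠ 0) :
    cellBubble x hx n l₀ α = arrayField hx n (cellArray n l₀ α) := by
  obtain ⟨β, rfl⟩ := exists_eq_add_unitIndex hl
  have hβ := (add_unitIndex_mem l₀).1 hα
  ext1 y
  rw [cellBubble, grad_bernstein hx hα, grad_bary,
    add_tsub_cancel_right]
  have h : cellArray n l₀ (β + unitIndex l₀) =
      (fun γ l => if l = l₀ then (if β + unitIndex l₀ = γ + unitIndex l₀ then (n : ℝ) + 1 else 0)
        else 0) - ((((β + unitIndex l₀) l₀ : ℕ) : ℝ) / ((n : ℝ) + 1)) • fun γ l =>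
          if β + unitIndex l₀ = γ + unitIndex l then (n : ℝ) + 1 else 0 := by
    ext γ l
    have hn : (n : ℝ) + 1 ≠ 0 := by positivity
    simp only [cellArray, Pi.sub_apply, Pi.smul_apply, smul_eq_mul]
    by_cases h1 : l = l₀
    · subst h1
      split_ifs <;> field_simp <;> simp
    · simp only [h1, if_false]
      split_ifs <;> field_simp
      simp
  rw [h, map_sub, map_smul, Pi.sub_apply, Pi.smul_apply]
  congr 1
  rw [arrayField_apply, sum_ite_smul_baryGrad]
  simp only [ite_mul, zero_mul]
  rw [sum_ite_eq_add_unitIndex hβ]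

/-! ### Uniqueness of the coefficients -/

/-- A function on a face that satisfies the discrete mean value property and vanishes at one index
of the face is nowhere positive. -/
theorem nonpos_of_mean_value {m : Fin 4} {k : ℕ} {f : MultiIndex → ℝ} {r : MultiIndex}
    (hr : r ∈ faceIndexSet m k) (hfr : f r = 0)
    (h : ∀ γ ∈ faceIndexSet m k, ∑ i ∈ Finset.univ.erase m, ∑ j ∈ Finset.univ.erase m,
      ((γ i : ℝ) + 1) * γ j * (f γ - f (γ + unitIndex i - unitIndex j)) = 0)
    {γ : MultiIndex} (hγ : γ ∈ faceIndexSet m k) : f γ ≤ 0 := by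
  have hmem : ∀ γ, γ ∈ (indexFinset k).filter (fun γ => γ m = 0) ↔ γ ∈ faceIndexSet m k := by
    intro γ; simp [mem_indexFinset, faceIndexSet]
  obtain ⟨M, hM, hmax⟩ := Finset.exists_max_image ((indexFinset k).filter (fun γ => γ m = 0)) f
    ⟨r, (hmem r).2 hr⟩
  rw [hmem] at hM
  replace hmax : ∀ γ ∈ faceIndexSet m k, f γ ≤ f M := fun γ hγ => hmax γ ((hmem γ).2 hγ)
  -- among the maximizers take one that is closest to `r`
  have key : ∀ d : ℕ, ∀ γ ∈ faceIndexSet m k, f γ = f M → ∑ i, (γ i - r i) = d → f r = f M := by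
    intro d
    induction d with
    | zero =>
      intro γ hγ hfγ hd
      have h0 : ∀ i, γ i ≤ r i := by
        intro i
        have := (Finset.sum_eq_zero_iff.1 hd) i (Finset.mem_univ i)
        omega
      have h1 : γ = r := by
        funext i
        refine ((Finset.sum_eq_sum_iff_of_le fun i _ => h0 i).1 ?_) i (Finset.mem_univ i)
        exact hγ.1.trans hr.1.symm
      rw [← h1, hfγ]
    | succ d ih =>
      intro γ hγ hfγ hd
      -- The truncated differences measure only the excess of `γ` over `r`. Equal totals force one
      -- entry in excess and one in deficit, and neither is `m`, where both indices are zero.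
      obtain ⟨j, hj⟩ : ∃ j, r j < γ j := by
        by_contra! hcon
        have : ∑ i, (γ i - r i) = 0 := Finset.sum_eq_zero fun i _ => by have := hcon i; omega
        omega
      obtain ⟨i, hi⟩ : ∃ i, γ i < r i := by
        by_contra! hcon
        have h1 : ∑ i, r i < ∑ i, γ i :=
          Finset.sum_lt_sum (fun i _ => hcon i) ⟨j, Finset.mem_univ j, hj⟩
        have h2 : ∑ i, γ i = k := hγ.1
        have h3 : ∑ i, r i = k := hr.1
        omega
      have hij : i ≠ j := by rintro rfl; omega
      have him : i ≠ m := by rintro rfl; have := hr.2; omega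
      have hjm : j ≠ m := by rintro rfl; have := hγ.2; omega
      have move : ∀ p ≠ m, ∀ q ≠ m, γ q ≠ 0 →
          γ + unitIndex p - unitIndex q ∈ faceIndexSet m k := by
        intro p hp q hq hγq
        obtain ⟨δ, rfl⟩ := exists_eq_add_unitIndex hγq
        rw [add_right_comm, add_tsub_cancel_right]
        have h1 := hγ.2
        obtain ⟨k', rfl⟩ : ∃ k', k = k' + 1 := by
          have h2 : ∑ a, (δ + unitIndex q) a = k := hγ.1
          simp only [Pi.add_apply, Finset.sum_add_distrib] at h2
          simp at h2
          exact ⟨_, h2.symm⟩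
        refine ⟨(add_unitIndex_mem p).2 ((add_unitIndex_mem q).1 hγ.1), ?_⟩
        simp at h1
        simp [h1, hp.symm]
      -- At a maximizer all terms of the mean value sum are nonnegative, so each is zero and every
      -- neighbour with positive weight is again a maximizer.
      have hterm : ∀ i ∈ Finset.univ.erase m, ∀ j ∈ Finset.univ.erase m,
          0 ≤ ((γ i : ℝ) + 1) * γ j * (f γ - f (γ + unitIndex i - unitIndex j)) := by
        intro i hi j hj
        by_cases hγj : γ j = 0
        · simp [hγj]
        · have := hmax _ (move i (Finset.ne_of_mem_erase hi) j (Finset.ne_of_mem_erase hj) hγj)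
          refine mul_nonneg (by positivity) ?_
          linarith
      have h1 := (Finset.sum_eq_zero_iff_of_nonneg fun i hi => Finset.sum_nonneg (hterm i hi)).1
        (h γ hγ) i (by simp [him])
      have h2 := (Finset.sum_eq_zero_iff_of_nonneg (hterm i (by simp [him]))).1 h1 j (by simp [hjm])
      have hγj : γ j ≠ 0 := by omega
      have h3 : ((γ i : ℝ) + 1) * γ j ≠ 0 := by positivity
      have h4 := (mul_eq_zero.1 h2).resolve_left h3
      refine ih _ (move i him j hjm hγj) (by linarith) ?_
      -- The move lowers the excess at `j` by one; at `i` the deficit keeps the truncated difference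
      -- zero.
      have h5 : ∀ a, (γ + unitIndex i - unitIndex j) a - r a =
          if a = j then γ a - r a - 1 else γ a - r a := by
        intro a
        rcases eq_or_ne a j with rfl | ha
        · simp [hij.symm]; omega
        · rcases eq_or_ne a i with rfl | ha'
          · simp [ha]; omega
          · simp [ha, ha']
      have h6 : ∑ a, (γ a - r a) = (∑ a, ((γ + unitIndex i - unitIndex j) a - r a)) + 1 := by
        simp only [h5]
        rw [← Finset.add_sum_erase _ _ (Finset.mem_univ j),
          ← Finset.add_sum_erase Finset.univ (fun a => if a = j then _ else _) (Finset.mem_univ j)]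
        have : ∑ a ∈ Finset.univ.erase j, (if a = j then γ a - r a - 1 else γ a - r a) =
            ∑ a ∈ Finset.univ.erase j, (γ a - r a) :=
          Finset.sum_congr rfl fun a ha => by simp [Finset.ne_of_mem_erase ha]
        rw [this]
        simp
        omega
      omega
  have := key _ M hM rfl rfl
  have := hmax γ hγ
  linarith

/-- The mean value property is linear, so the maximum principle applies to `f` and to `-f`. -/
theorem eq_zero_of_mean_value {m : Fin 4} {k : ℕ} {f : MultiIndex → ℝ} {r : MultiIndex}
    (hr : r ∈ faceIndexSet m k) (hfr : f r = 0)
    (h : ∀ γ ∈ faceIndexSet m k, ∑ i ∈ Finset.univ.erase m, ∑ j ∈ Finset.univ.erase m,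
      ((γ i : ℝ) + 1) * γ j * (f γ - f (γ + unitIndex i - unitIndex j)) = 0)
    {γ : MultiIndex} (hγ : γ ∈ faceIndexSet m k) : f γ = 0 := by
  refine le_antisymm (nonpos_of_mean_value hr hfr h hγ) ?_
  have := nonpos_of_mean_value (f := fun γ => - f γ) hr (by simp [hfr]) (fun γ hγ => by
    rw [← neg_zero, ← h γ hγ]
    simp only [← Finset.sum_neg_distrib]
    refine Finset.sum_congr rfl fun i _ => Finset.sum_congr rfl fun j _ => by ring) hγ
  linarith

/-- The total coefficient array of a linear combination of the basis functions in degree `k + 1`. -/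
def totalArray (σ : Fin 4 → Equiv.Perm (Fin 4)) (k : ℕ) (w : EdgeIndex → ℝ) (g : MultiIndex → ℝ)
    (f h : Fin 4 → MultiIndex → ℝ) (β : MultiIndex) (l : Fin 4) : ℝ :=
  (∑ e : EdgeIndex, w e * whitneyArray (k + 1) e.1.1 e.1.2 β l) +
  ((k : ℝ) + 2) * g (β + unitIndex l) +
  (∑ m, ∑ α ∈ indexFinset k, f m α * faceArray (σ m) α β l) +
  (((k : ℝ) + 2) * h l (β + unitIndex l) -
    ∑ j, h j (β + unitIndex l) * ((β + unitIndex l) j : ℝ))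

/-! ### Vanishing of the edge, face and interior coefficients -/

section Uniqueness

variable {σ : Fin 4 → Equiv.Perm (Fin 4)} {k : ℕ} {w : EdgeIndex → ℝ}
  {g : MultiIndex → ℝ} {f h : Fin 4 → MultiIndex → ℝ}

/-- The face terms vanish when the face is not compatible with the multi-index and direction. -/
theorem faceSum_eq_zero {s : Equiv.Perm (Fin 4)} {φ : MultiIndex → ℝ}
    (hφ : ∀ α, α ∉ faceIndexSet (s 3) k → φ α = 0) {β : MultiIndex} {l l' : Fin 4}
    (hl : l' ≠ l) (hβ : β l' = 0) (hs : l' = s 3 → l = s 3) :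
    ∑ α ∈ indexFinset k, φ α * faceArray s α β l = 0 := by
  refine Finset.sum_eq_zero fun α _ => ?_
  by_cases hα : α ∈ faceIndexSet (s 3) k
  swap
  · simp [hφ α hα]
  refine mul_eq_zero_of_right _ ?_
  obtain ⟨a, rfl⟩ := s.surjective l
  obtain ⟨b, rfl⟩ := s.surjective l'
  simp only [ne_eq, EmbeddingLike.apply_eq_iff_eq] at hl hs
  simp only [faceArray, EmbeddingLike.apply_eq_iff_eq]
  -- The hypotheses make `l'` a vertex of the face other than `l`. If `l` is on the face, its
  -- prefactor contains `β l' = 0`; if `l` is opposite, no term is present.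
  fin_cases a <;> fin_cases b <;> simp_all

/-- For `β` supported on the edge, comparing the two directions along the edge leaves only the
gradients and this edge's Whitney form, so `g` has constant increments along the edge and vanishes
at both ends. -/
theorem edge_step (hgv : ∀ l : Fin 4, g ((k + 2) • Pi.single l 1) = 0)
    (hf : ∀ m α, α ∉ faceIndexSet m k → f m α = 0)
    (hh : ∀ l α, α ∉ interiorIndexSet (k + 2) → h l α = 0) (hσ : ∀ m, σ m 3 = m)
    (hT : ∀ β ∈ indexSet (k + 1), ∀ l l', totalArray σ k w g f h β l =
      totalArray σ k w g f h β l') (e : EdgeIndex) :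
    w e = 0 ∧ ∀ α ∈ indexSet (k + 2), (∀ l, l ≠ e.1.1 → l ≠ e.1.2 → α l = 0) → g α = 0 := by
  obtain ⟨⟨a, b⟩, hab⟩ := e
  simp only at hab ⊢
  have hne : a ≠ b := hab.ne
  obtain ⟨c, hca, hcb⟩ : ∃ c : Fin 4, c ≠ a ∧ c ≠ b := by
    revert a b; decide
  -- differences of `g` along the edge
  have diff : ∀ β ∈ indexSet (k + 1), (∀ l, l ≠ a → l ≠ b → β l = 0) →
      ((k : ℝ) + 2) * (g (β + unitIndex b) - g (β + unitIndex a)) = - w ⟨(a, b), hab⟩ := by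
    intro β hβ hsupp
    have hsum : (β a : ℝ) + β b = k + 1 := by
      have h1 : ∑ i, β i = k + 1 := hβ
      rw [Finset.sum_eq_add a b hne (fun l _ hl => hsupp l hl.1 hl.2) (by simp) (by simp)] at h1
      exact_mod_cast h1
    have hhz : ∀ l j, l ≠ c → h j (β + unitIndex l) = 0 := by
      intro l j hl
      refine hh _ _ fun hmem => ?_
      have := hmem.2 c
      simp [hsupp c hca hcb, hl.symm] at this
    have hfz : ∀ m l, (l = a ∨ l = b) →
        ∑ α ∈ indexFinset k, f m α * faceArray (σ m) α β l = 0 := by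
      intro m l hl
      -- Two vertices lie off the edge, so at least one of them differs from `m`; it is a vertex of
      -- the face at which `β` vanishes.
      obtain ⟨d, hd1, hd2, hd3⟩ : ∃ d : Fin 4, d ≠ a ∧ d ≠ b ∧ d ≠ m := by
        clear * - hne
        revert a b m; decide
      refine faceSum_eq_zero (l' := d) (fun α hα => hf m α (by rwa [hσ] at hα)) ?_
        (hsupp d hd1 hd2) ?_
      · rcases hl with rfl | rfl <;> assumption
      · rw [hσ]; exact fun h => absurd h hd3
    -- The own edge contributes `(β a + β b) / (k + 1) = 1`; any other edge contributes only entries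
    -- of `β` off the edge, which are zero.
    have hw : (∑ e : EdgeIndex, w e * whitneyArray (k + 1) e.1.1 e.1.2 β b) -
        (∑ e : EdgeIndex, w e * whitneyArray (k + 1) e.1.1 e.1.2 β a) = w ⟨(a, b), hab⟩ := by
      rw [← Finset.sum_sub_distrib, Finset.sum_eq_single ⟨(a, b), hab⟩]
      · have hk : (k : ℝ) + 1 ≠ 0 := by positivity
        simp only [whitneyArray, hne, hne.symm, if_true, if_false]
        push_cast
        rw [← mul_sub]
        have : (β a : ℝ) / (k + 1) - 0 - (0 - (β b : ℝ) / (k + 1)) = 1 := by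
          field_simp
          linarith
        rw [this, mul_one]
      · rintro ⟨⟨i, j⟩, hij⟩ _ hne'
        simp only at hij
        have hij' : i ≠ j := hij.ne
        have hne'' : ¬ (i = a ∧ j = b) := by
          rintro ⟨rfl, rfl⟩; exact hne' rfl
        rw [← mul_sub]
        refine mul_eq_zero_of_right _ ?_
        simp only [whitneyArray]
        have hz : ∀ l, l ≠ a → l ≠ b → (β l : ℝ) = 0 := fun l h1 h2 => by
          exact_mod_cast hsupp l h1 h2
        have hba : ¬ b < a := hab.asymm
        rcases eq_or_ne i a with rfl | hia
        · have hjb : j ≠ b := fun h => hne'' ⟨rfl, h⟩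
          simp [hjb.symm, hne.symm, hij', hz j hij'.symm hjb]
        · rcases eq_or_ne i b with rfl | hib
          · have hja : j ≠ a := by rintro rfl; exact hba hij
            simp [hij', hne, hja.symm, hz j hja hij'.symm]
          · simp [hz i hia hib, hia.symm, hib.symm]
      · simp
    have := hT β hβ b a
    simp only [totalArray] at this
    rw [Finset.sum_eq_zero fun m _ => hfz m b (Or.inr rfl),
      Finset.sum_eq_zero fun m _ => hfz m a (Or.inl rfl)] at this
    simp only [hhz a _ hca.symm, hhz b _ hcb.symm] at this
    simp at this
    linarith
  have diff' : ∀ t s : ℕ, t + s = k + 1 → ((k : ℝ) + 2) *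
      (g ((t + 1) • unitIndex b + s • unitIndex a) - g (t • unitIndex b + (s + 1) • unitIndex a)) =
      - w ⟨(a, b), hab⟩ := by
    intro t s hts
    have := diff (t • unitIndex b + s • unitIndex a)
      (by simp [indexSet, Finset.sum_add_distrib, ← Finset.mul_sum, hts])
      (fun l h1 h2 => by simp [h1, h2])
    rw [← this, succ_nsmul (unitIndex b), succ_nsmul (unitIndex a), add_right_comm, ← add_assoc]
  have lin : ∀ t s : ℕ, t + s = k + 2 → ((k : ℝ) + 2) *
      g (t • unitIndex b + s • unitIndex a) = - t * w ⟨(a, b), hab⟩ := by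
    intro t
    induction t with
    | zero =>
      intro s hs
      have : s = k + 2 := by omega
      subst this
      simp only [zero_smul, zero_add]
      rw [hgv a]; simp
    | succ t ih =>
      intro s hs
      have h1 := ih (s + 1) (by omega)
      have h2 := diff' t s (by omega)
      push_cast
      linarith
  have hk : (k : ℝ) + 2 ≠ 0 := by positivity
  -- The progression starts at zero; its last term, at the vertex `b`, is zero as well, so the step
  -- is zero.
  have hw : w ⟨(a, b), hab⟩ = 0 := by
    have h1 := lin (k + 2) 0 (by omega)
    simp only [zero_smul, add_zero] at h1
    rw [hgv b, mul_zero] at h1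
    push_cast at h1
    have h2 : ((k : ℝ) + 2) * w ⟨(a, b), hab⟩ = 0 := by linarith
    exact (mul_eq_zero.1 h2).resolve_left hk
  refine ⟨hw, fun α hα hsupp => ?_⟩
  have h1 : α = α b • unitIndex b + α a • unitIndex a := by
    funext l
    rcases eq_or_ne l a with rfl | h1
    · simp [hne]
    · rcases eq_or_ne l b with rfl | h2
      · simp [hne.symm]
      · simp [hsupp l h1 h2, h1, h2]
  have h2 : α b + α a = k + 2 := by
    have h3 : ∑ i, α i = k + 2 := hα
    rw [Finset.sum_eq_add a b hne (fun l _ hl => hsupp l hl.1 hl.2) (by simp) (by simp)] at h3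
    omega
  have h3 := lin _ _ h2
  rw [← h1, hw, mul_zero] at h3
  exact (mul_eq_zero.1 h3).resolve_left hk

/-- The sum over `α` that picks `φ (β - e_j)`. -/
def shiftSum (k : ℕ) (φ : MultiIndex → ℝ) (j : Fin 4) (β : MultiIndex) : ℝ :=
  ∑ α ∈ indexFinset k, φ α * if β = α + unitIndex j then 1 else 0

theorem shiftSum_add_unitIndex {φ : MultiIndex → ℝ} {γ : MultiIndex} (hγ : γ ∈ indexSet k)
    (j : Fin 4) : shiftSum k φ j (γ + unitIndex j) = φ γ := by
  rw [shiftSum, ← sum_ite_eq_add_unitIndex hγ j φ]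
  exact Finset.sum_congr rfl fun α _ => by simp

/-- The factor `γ j` guards the truncated subtraction: it kills both sides when `γ j = 0`. -/
theorem mul_shiftSum {φ : MultiIndex → ℝ} {γ : MultiIndex} (hγ : γ ∈ indexSet k) (i j : Fin 4) :
    (γ j : ℝ) * shiftSum k φ j (γ + unitIndex i) =
      γ j * φ (γ + unitIndex i - unitIndex j) := by
  by_cases hj : γ j = 0
  · simp [hj]
  · obtain ⟨δ, rfl⟩ := exists_eq_add_unitIndex hj
    congr 1
    have hδ : δ + unitIndex i ∈ indexSet k := by
      simpa [indexSet, Finset.sum_add_distrib] using hγ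
    rw [add_right_comm, add_tsub_cancel_right, shiftSum_add_unitIndex hδ]

theorem sum_mul_faceArray (s : Equiv.Perm (Fin 4)) (φ : MultiIndex → ℝ) (β : MultiIndex) :
    (∑ α ∈ indexFinset k, φ α * faceArray s α β (s 0) =
      β (s 1) * β (s 2) * (shiftSum k φ (s 2) β - shiftSum k φ (s 1) β)) ∧
    (∑ α ∈ indexFinset k, φ α * faceArray s α β (s 1) =
      β (s 2) * β (s 0) * (shiftSum k φ (s 0) β - shiftSum k φ (s 2) β)) ∧
    (∑ α ∈ indexFinset k, φ α * faceArray s α β (s 2) =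
      β (s 0) * β (s 1) * (shiftSum k φ (s 1) β - shiftSum k φ (s 0) β)) := by
  simp only [shiftSum, ← Finset.sum_sub_distrib, Finset.mul_sum]
  refine ⟨?_, ?_, ?_⟩ <;> refine Finset.sum_congr rfl fun α _ => ?_ <;>
    simp only [faceArray, EmbeddingLike.apply_eq_iff_eq] <;>
    generalize (if β = α + unitIndex (s 0) then (1 : ℝ) else 0) = A <;>
    generalize (if β = α + unitIndex (s 1) then (1 : ℝ) else 0) = B <;>
    generalize (if β = α + unitIndex (s 2) then (1 : ℝ) else 0) = C <;> simp <;> ring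

/-- For `β m = 0` and directions along the face, cell bubbles and the bubbles of other faces drop
out. What remains couples the gradients with the bubbles of this face. -/
theorem face_step (hf : ∀ m α, α ∉ faceIndexSet m k → f m α = 0)
    (hh : ∀ l α, α ∉ interiorIndexSet (k + 2) → h l α = 0) (hσ : ∀ m, σ m 3 = m)
    (hT : ∀ β ∈ indexSet (k + 1), ∀ l l', totalArray σ k w g f h β l =
      totalArray σ k w g f h β l')
    (hw : ∀ e, w e = 0)
    (hg : ∀ α ∈ indexSet (k + 2), ∀ m m', m ≠ m' → α m = 0 → α m' = 0 → g α = 0)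
    (m : Fin 4) {r : MultiIndex} (hr : r ∈ faceIndexSet m k) (hfr : f m r = 0) :
    (∀ α, f m α = 0) ∧ ∀ α ∈ indexSet (k + 2), α m = 0 → g α = 0 := by
  have eqn : ∀ β ∈ indexSet (k + 1), β m = 0 → ∀ l l', l ≠ m → l' ≠ m →
      ((k : ℝ) + 2) * g (β + unitIndex l) +
        ∑ α ∈ indexFinset k, f m α * faceArray (σ m) α β l =
      ((k : ℝ) + 2) * g (β + unitIndex l') +
        ∑ α ∈ indexFinset k, f m α * faceArray (σ m) α β l' := by
    intro β hβ hm
    have tot : ∀ l, l ≠ m → totalArray σ k w g f h β l = ((k : ℝ) + 2) * g (β + unitIndex l) +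
        ∑ α ∈ indexFinset k, f m α * faceArray (σ m) α β l := by
      intro l hl
      have hhz : ∀ j, h j (β + unitIndex l) = 0 := by
        intro j
        refine hh _ _ fun hmem => ?_
        have := hmem.2 m
        simp [hm, hl.symm] at this
      have hfz : ∀ m' ∈ Finset.univ, m' ≠ m →
          ∑ α ∈ indexFinset k, f m' α * faceArray (σ m') α β l = 0 := by
        intro m' _ hm'
        refine faceSum_eq_zero (l' := m) (fun α hα => hf m' α (by rwa [hσ] at hα)) hl.symm hm ?_
        rw [hσ]; exact fun h => absurd h.symm hm'
      rw [totalArray, Finset.sum_eq_single m hfz (by simp)]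
      simp [hw, hhz]
    intro l l' hl hl'
    rw [← tot l hl, ← tot l' hl']
    exact hT β hβ l l'
  have hs : ∀ a : Fin 4, a ≠ 3 → σ m a ≠ m := by
    intro a ha h
    rw [← hσ m] at h
    exact ha ((σ m).injective (by rwa [hσ m] at h ⊢))
  have h0 := hs 0 (by decide)
  have h1 := hs 1 (by decide)
  have h2 := hs 2 (by decide)
  have huniv : Finset.univ.erase m = {σ m 0, σ m 1, σ m 2} := by
    ext l
    obtain ⟨a, rfl⟩ := (σ m).surjective l
    have h3 : σ m a ≠ m ↔ a ≠ 3 := by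
      conv_lhs => rw [← hσ m]
      rw [hσ m, ← hσ m]
      simp [hσ m]
      constructor
      · rintro h rfl; exact h (hσ m)
      · exact hs a
    simp only [Finset.mem_erase, h3, Finset.mem_univ, and_true, Finset.mem_insert,
      Finset.mem_singleton, EmbeddingLike.apply_eq_iff_eq]
    clear h3
    revert a; decide
  have f0 : ∀ α, f m α = 0 := by
    intro α
    by_cases hα : α ∈ faceIndexSet m k
    swap
    · exact hf m α hα
    refine eq_zero_of_mean_value hr hfr ?_ hα
    intro γ hγ
    have hmem : ∀ i, γ + unitIndex i ∈ indexSet (k + 1) := fun i => (add_unitIndex_mem i).2 hγ.1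
    have hz : ∀ i, i ≠ m → (γ + unitIndex i) m = 0 := by
      intro i hi; simp [hγ.2, hi.symm]
    -- At each `γ + e_i` compare the other two directions, in cyclic order. Each `g (γ + e_i + e_j)`
    -- then occurs once on either side, so the sum of the three equations involves `f m` alone.
    have e0 := eqn _ (hmem (σ m 0)) (hz _ h0) _ _ h1 h2
    have e1 := eqn _ (hmem (σ m 1)) (hz _ h1) _ _ h2 h0
    have e2 := eqn _ (hmem (σ m 2)) (hz _ h2) _ _ h0 h1
    have c01 : γ + unitIndex (σ m 0) + unitIndex (σ m 1) =
        γ + unitIndex (σ m 1) + unitIndex (σ m 0) := add_right_comm _ _ _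
    have c02 : γ + unitIndex (σ m 0) + unitIndex (σ m 2) =
        γ + unitIndex (σ m 2) + unitIndex (σ m 0) := add_right_comm _ _ _
    have c12 : γ + unitIndex (σ m 1) + unitIndex (σ m 2) =
        γ + unitIndex (σ m 2) + unitIndex (σ m 1) := add_right_comm _ _ _
    obtain ⟨s0, s1, s2⟩ := sum_mul_faceArray (k := k) (σ m) (f m) (γ + unitIndex (σ m 0))
    obtain ⟨t0, t1, t2⟩ := sum_mul_faceArray (k := k) (σ m) (f m) (γ + unitIndex (σ m 1))
    obtain ⟨u0, u1, u2⟩ := sum_mul_faceArray (k := k) (σ m) (f m) (γ + unitIndex (σ m 2))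
    rw [s1, s2, c01, c02] at e0
    rw [t2, t0, c12] at e1
    rw [u0, u1] at e2
    have e : ∀ i j : Fin 4, i ≠ j → ((γ + unitIndex i) j : ℝ) = γ j := by
      intro i j h; simp [h.symm]
    have e' : ∀ i : Fin 4, ((γ + unitIndex i) i : ℝ) = γ i + 1 := by
      intro i; simp
    have h01 : σ m 0 ≠ σ m 1 := by simp
    have h02 : σ m 0 ≠ σ m 2 := by simp
    have h12 : σ m 1 ≠ σ m 2 := by simp
    rw [e _ _ h01, e _ _ h02, e', shiftSum_add_unitIndex hγ.1] at e0
    rw [e _ _ h01.symm, e _ _ h12, e', shiftSum_add_unitIndex hγ.1] at e1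
    rw [e _ _ h02.symm, e _ _ h12.symm, e', shiftSum_add_unitIndex hγ.1] at e2
    have m01 := mul_shiftSum (φ := f m) hγ.1 (σ m 0) (σ m 1)
    have m02 := mul_shiftSum (φ := f m) hγ.1 (σ m 0) (σ m 2)
    have m10 := mul_shiftSum (φ := f m) hγ.1 (σ m 1) (σ m 0)
    have m12 := mul_shiftSum (φ := f m) hγ.1 (σ m 1) (σ m 2)
    have m20 := mul_shiftSum (φ := f m) hγ.1 (σ m 2) (σ m 0)
    have m21 := mul_shiftSum (φ := f m) hγ.1 (σ m 2) (σ m 1)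
    have hsum : ∀ F : Fin 4 → ℝ, ∑ i ∈ Finset.univ.erase m, F i =
        F (σ m 0) + F (σ m 1) + F (σ m 2) := by
      intro F
      rw [huniv, Finset.sum_insert (by simp), Finset.sum_insert (by simp), Finset.sum_singleton,
        add_assoc]
    simp only [hsum, add_tsub_cancel_right, sub_self, mul_zero, add_zero, zero_add]
    linear_combination e0 + e1 + e2 + (γ (σ m 0) + 1 : ℝ) * (m01 + m02) +
      (γ (σ m 1) + 1 : ℝ) * (m10 + m12) + (γ (σ m 2) + 1 : ℝ) * (m20 + m21)
  refine ⟨f0, ?_⟩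
  have hk : (k : ℝ) + 2 ≠ 0 := by positivity
  have move : ∀ β ∈ indexSet (k + 1), β m = 0 →
      g (β + unitIndex (σ m 0)) = g (β + unitIndex (σ m 1)) := by
    intro β hβ hm
    have := eqn β hβ hm _ _ h0 h1
    simp only [f0, zero_mul, Finset.sum_const_zero, add_zero] at this
    exact mul_left_cancel₀ hk this
  -- Without bubbles `g` is unchanged when a unit of mass moves between two face vertices; emptying
  -- one entry ends on an edge, where `g` is already zero.
  have key : ∀ t, ∀ α ∈ indexSet (k + 2), α m = 0 → α (σ m 1) = t → g α = 0 := by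
    intro t
    induction t with
    | zero =>
      intro α hα hm ht
      exact hg α hα m (σ m 1) h1.symm hm ht
    | succ t ih =>
      intro α hα hm ht
      obtain ⟨β, rfl⟩ := exists_eq_add_unitIndex (α := α) (l := σ m 1) (by omega)
      have hβ := (add_unitIndex_mem _).1 hα
      have hβm : β m = 0 := by simpa [h1.symm] using hm
      rw [← move β hβ hβm]
      refine ih _ ((add_unitIndex_mem _).2 hβ) (by simp [hβm, h0.symm]) ?_
      simpa using ht
  exact fun α hα hm => key _ α hα hm rfl

/-- With `h 3 = 0`, direction `3` exposes the common value as `G (β + e_3)`. Once that is zero, `G`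
vanishes identically, then every `h l`, then `g`. -/
theorem interior_step
    (hh : ∀ l α, α ∉ interiorIndexSet (k + 2) → h l α = 0)
    (hh3 : ∀ α, h 3 α = 0) (hh2 : ∀ α, α 2 ≠ 1 → h 2 α = 0)
    (hT : ∀ β ∈ indexSet (k + 1), ∀ l l', totalArray σ k w g f h β l =
      totalArray σ k w g f h β l')
    (hw : ∀ e, w e = 0) (hf : ∀ m α, f m α = 0)
    (hg : ∀ α, α ∉ interiorIndexSet (k + 2) → g α = 0) :
    (∀ α, g α = 0) ∧ ∀ l α, h l α = 0 := by
  have tot : ∀ β l, totalArray σ k w g f h β l = ((k : ℝ) + 2) * g (β + unitIndex l) +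
      (((k : ℝ) + 2) * h l (β + unitIndex l) -
        ∑ j, h j (β + unitIndex l) * ((β + unitIndex l) j : ℝ)) := by
    intro β l
    simp [totalArray, hw, hf]
  simp only [tot] at hT
  have hk : (k : ℝ) + 2 ≠ 0 := by positivity
  -- `G` collects the part of the array that depends on `β` and `l` only through `β + e_l`.
  set G : MultiIndex → ℝ := fun α => ((k : ℝ) + 2) * g α - ∑ j, h j α * (α j : ℝ) with hG
  have hT' : ∀ β ∈ indexSet (k + 1), ∀ l l', ((k : ℝ) + 2) * h l (β + unitIndex l) +
      G (β + unitIndex l) = ((k : ℝ) + 2) * h l' (β + unitIndex l') + G (β + unitIndex l') := by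
    intro β hβ l l'
    have := hT β hβ l l'
    simp only [hG]
    linarith
  have hGz : ∀ α, α ∉ interiorIndexSet (k + 2) → G α = 0 := by
    intro α hα
    simp [hG, hg α hα, hh _ α hα]
  -- the common value vanishes, by moving the mass of the last entry to the third one
  have key : ∀ t, ∀ β ∈ indexSet (k + 1), β 3 = t → G (β + unitIndex 3) = 0 := by
    intro t
    induction t with
    | zero =>
      intro β hβ ht
      have h1 := hT' β hβ 3 0
      rw [hh3, mul_zero, zero_add] at h1
      have h2 : β + unitIndex 0 ∉ interiorIndexSet (k + 2) := by
        intro hmem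
        have := hmem.2 3
        simp [ht] at this
      rw [h1, hh 0 _ h2, hGz _ h2]
      simp
    | succ t ih =>
      intro β hβ ht
      by_cases h2 : β + unitIndex 2 ∈ interiorIndexSet (k + 2)
      swap
      · have h1 := hT' β hβ 3 2
        rw [hh3, mul_zero, zero_add] at h1
        rw [h1, hh 2 _ h2, hGz _ h2]
        simp
      by_cases hβ2 : β 2 = 0
      · have h3 : β + unitIndex 3 ∉ interiorIndexSet (k + 2) := by
          intro hmem
          have := hmem.2 2
          simp [hβ2] at this
        exact hGz _ h3
      have h1 := hT' β hβ 3 2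
      -- Entry `2` of `β + e_2` is at least two, so `h 2` vanishes there and `G` may be moved from
      -- `β + e_3` to `β + e_2`, which lowers entry `3`.
      rw [hh3, mul_zero, zero_add, hh2 _ (by simpa using hβ2), mul_zero, zero_add] at h1
      obtain ⟨δ, rfl⟩ := exists_eq_add_unitIndex (α := β) (l := 3) (by omega)
      rw [h1, add_right_comm]
      refine ih _ ((add_unitIndex_mem _).2 ((add_unitIndex_mem _).1 hβ)) ?_
      simpa using ht
  have val : ∀ β ∈ indexSet (k + 1), ∀ l, ((k : ℝ) + 2) * h l (β + unitIndex l) +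
      G (β + unitIndex l) = 0 := by
    intro β hβ l
    rw [hT' β hβ l 3, hh3, key _ β hβ rfl]
    simp
  have hG0 : ∀ α, G α = 0 := by
    intro α
    by_cases hα : α ∈ interiorIndexSet (k + 2)
    · obtain ⟨β, rfl⟩ := exists_eq_add_unitIndex (α := α) (l := 3) (hα.2 3).ne'
      exact key _ β ((add_unitIndex_mem _).1 hα.1) rfl
    · exact hGz α hα
  have h0 : ∀ l α, h l α = 0 := by
    intro l α
    by_cases hα : α ∈ interiorIndexSet (k + 2)
    · obtain ⟨β, rfl⟩ := exists_eq_add_unitIndex (α := α) (l := l) (hα.2 l).ne'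
      have := val β ((add_unitIndex_mem _).1 hα.1) l
      rw [hG0, add_zero] at this
      exact (mul_eq_zero.1 this).resolve_left hk
    · exact hh l α hα
  refine ⟨fun α => ?_, h0⟩
  have := hG0 α
  simp only [hG, h0, zero_mul, Finset.sum_const_zero, sub_zero] at this
  exact (mul_eq_zero.1 this).resolve_left hk

/-- A linear combination of the basis functions whose total coefficient array does not depend on
the direction is trivial. -/
theorem coefficients_eq_zero (hgv : ∀ α, α ∉ nonVertexIndexSet (k + 2) → g α = 0)
    (hf : ∀ m α, α ∉ faceIndexSet m k → f m α = 0)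
    {r : Fin 4 → MultiIndex} (hr : ∀ m, r m ∈ faceIndexSet m k) (hfr : ∀ m, f m (r m) = 0)
    (hh : ∀ l α, α ∉ interiorIndexSet (k + 2) → h l α = 0)
    (hh3 : ∀ α, h 3 α = 0) (hh2 : ∀ α, α 2 ≠ 1 → h 2 α = 0) (hσ : ∀ m, σ m 3 = m)
    (hT : ∀ β ∈ indexSet (k + 1), ∀ l l', totalArray σ k w g f h β l =
      totalArray σ k w g f h β l') :
    (∀ e, w e = 0) ∧ (∀ α, g α = 0) ∧ (∀ m α, f m α = 0) ∧ ∀ l α, h l α = 0 := by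
  have hv : ∀ l : Fin 4, g ((k + 2) • Pi.single l 1) = 0 :=
    fun l => hgv _ fun hmem => hmem.2 l rfl
  have he := edge_step hv hf hh hσ hT
  have hw : ∀ e, w e = 0 := fun e => (he e).1
  have hg2 : ∀ α ∈ indexSet (k + 2), ∀ m m', m ≠ m' → α m = 0 → α m' = 0 → g α = 0 := by
    intro α hα m m' hne hm hm'
    obtain ⟨a, b, hab, hcover⟩ : ∃ a b : Fin 4, a < b ∧
        ∀ l, l ≠ a → l ≠ b → l = m ∨ l = m' := by
      clear * - hne
      revert m m'; decide
    refine (he ⟨(a, b), hab⟩).2 α hα fun l h1 h2 => ?_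
    rcases hcover l h1 h2 with rfl | rfl <;> assumption
  have hface := fun m => face_step hf hh hσ hT hw hg2 m (hr m) (hfr m)
  have hf0 : ∀ m α, f m α = 0 := fun m => (hface m).1
  have hg3 : ∀ α, α ∉ interiorIndexSet (k + 2) → g α = 0 := by
    intro α hα
    by_cases hmem : α ∈ indexSet (k + 2)
    · obtain ⟨m, hm⟩ : ∃ m, α m = 0 := by
        by_contra! hcon
        exact hα ⟨hmem, fun l => Nat.pos_of_ne_zero (hcon l)⟩
      exact (hface m).2 α hmem hm
    · exact hgv α fun h => hmem h.1
  obtain ⟨hg0, hh0⟩ := interior_step hh hh3 hh2 hT hw hf0 hg3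
  exact ⟨hw, hg0, hf0, hh0⟩

end Uniqueness

open MvPolynomial

/-! ### Polynomials in Cartesian and in barycentric coordinates -/

-- The tetrahedron has interior points and so contains a box; a polynomial vanishing on a product of
-- infinite sets is zero. This makes degrees of polynomial functions on the tetrahedron meaningful.
include hx in
theorem polyEval_injective : Function.Injective (polyEval (tetra x)) := by
  have hne : (interior (tetra x)).Nonempty := by
    rw [tetra, interior_convexHull_nonempty_iff_affineSpan_eq_top]
    exact (vertexBasis x hx).tot
  obtain ⟨y, hy⟩ := hne
  obtain ⟨ε, hε, hball⟩ := Metric.isOpen_iff.1 isOpen_interior y hy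
  intro p q hpq
  refine funext_set (fun j => Metric.ball (y j) ε) (fun j => ?_) fun z hz => ?_
  · rw [Real.ball_eq_Ioo]
    exact Set.Ioo_infinite (by linarith)
  · have hz' : z ∈ tetra x := by
      refine interior_subset (hball ?_)
      rw [ball_pi _ hε]
      exact hz
    exact congrFun hpq ⟨z, hz'⟩

theorem mem_polySpace {K : Set R3} {n : ℕ} {f : K → ℝ} :
    f ∈ polySpace K n ↔ ∃ p : MvPolynomial (Fin 3) ℝ, p.totalDegree ≤ n ∧ ∀ y : K,
      f y = eval (y : R3) p := by
  simp only [polySpace, Submodule.mem_map, mem_restrictTotalDegree]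
  refine exists_congr fun p => and_congr_right fun _ => ?_
  rw [eq_comm, funext_iff]
  rfl

theorem mem_homPolySpace {K : Set R3} {n : ℕ} {f : K → ℝ} :
    f ∈ homPolySpace K n ↔ ∃ p : MvPolynomial (Fin 3) ℝ, p.IsHomogeneous n ∧ ∀ y : K,
      f y = eval (y : R3) p := by
  simp only [homPolySpace, Submodule.mem_map, mem_homogeneousSubmodule]
  refine exists_congr fun p => and_congr_right fun _ => ?_
  rw [eq_comm, funext_iff]
  rfl

/-- The barycentric coordinate `λ_l` as a polynomial. -/
def baryPoly (hx : AffineIndependent ℝ x) (l : Fin 4) : MvPolynomial (Fin 3) ℝ :=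
  ∑ j, C (baryGrad hx l j) * X j + C (bary x hx l 0)

theorem eval_baryPoly (l : Fin 4) (y : R3) : eval y (baryPoly hx l) = bary x hx l y := by
  rw [bary_eq, baryDeriv_eq_dotProduct]
  simp [baryPoly]

theorem totalDegree_baryPoly_le (l : Fin 4) : (baryPoly hx l).totalDegree ≤ 1 := by
  refine (totalDegree_add _ _).trans (max_le (totalDegree_finsetSum_le fun j _ => ?_) (by simp))
  refine (totalDegree_mul _ _).trans ?_
  simp

/-- The Bernstein polynomial as a polynomial in Cartesian coordinates. -/
def bernsteinPoly (hx : AffineIndependent ℝ x) (n : ℕ) (α : MultiIndex) :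
    MvPolynomial (Fin 3) ℝ :=
  C ((n.factorial : ℝ) / (∏ k, ((α k).factorial : ℝ))) * ∏ k, baryPoly hx k ^ α k

theorem eval_bernsteinPoly (n : ℕ) (α : MultiIndex) (y : R3) :
    eval y (bernsteinPoly hx n α) = bernstein x hx n α y := by
  simp [bernsteinPoly, bernstein, eval_baryPoly]

theorem totalDegree_bernsteinPoly_le {n : ℕ} {α : MultiIndex} (hα : α ∈ indexSet n) :
    (bernsteinPoly hx n α).totalDegree ≤ n := by
  refine (totalDegree_mul _ _).trans ?_
  rw [totalDegree_C, zero_add]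
  refine (totalDegree_finsetProd _ _).trans ?_
  have h : ∑ k, α k = n := hα
  rw [← h]
  refine Finset.sum_le_sum fun k _ => (totalDegree_pow _ _).trans ?_
  simpa using Nat.mul_le_mul_left (α k) (totalDegree_baryPoly_le hx k)

/-- Homogeneous polynomials in the barycentric coordinates have a Bernstein expansion. -/
theorem exists_bernstein_expansion_of_isHomogeneous {n : ℕ} {P : MvPolynomial (Fin 4) ℝ} (hP : P.IsHomogeneous n) :
    ∃ c : MultiIndex → ℝ, ∀ y, eval (fun k => bary x hx k y) P =
      ∑ β ∈ indexFinset n, c β * bernstein x hx n β y := by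
  refine ⟨fun β => coeff (Finsupp.equivFunOnFinite.symm β) P *
    ((∏ k, ((β k).factorial : ℝ)) / n.factorial), fun y => ?_⟩
  rw [eval_eq']
  refine Finset.sum_bij_ne_zero (fun d _ _ => (d : Fin 4 → ℕ)) ?_ ?_ ?_ ?_
  · intro d hd _
    rw [mem_indexFinset]
    have := hP (mem_support_iff.1 hd)
    have h1 : (Finsupp.weight 1) d = d.degree :=
      (DFunLike.congr_fun Finsupp.degree_eq_weight_one d).symm
    rwa [h1, Finsupp.degree_eq_sum] at this
  · intro d _ _ d' _ _ h
    exact DFunLike.coe_injective h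
  · intro β hβ h
    refine ⟨Finsupp.equivFunOnFinite.symm β, ?_, ?_, rfl⟩
    · rw [mem_support_iff]
      intro h0
      simp [h0] at h
    · intro h0
      apply h
      rw [bernstein]
      rcases mul_eq_zero.1 h0 with h0 | h0
      · simp [h0]
      · have : ∏ k, bary x hx k y ^ β k = 0 := h0
        simp [this]
  · intro d _ _
    have h1 := prod_factorial_ne_zero d
    have h2 : (n.factorial : ℝ) ≠ 0 := by exact_mod_cast n.factorial_ne_zero
    have h3 : Finsupp.equivFunOnFinite.symm (d : Fin 4 → ℕ) = d := by ext; rfl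
    simp only [bernstein, h3]
    field_simp

/-- Homogenization: substitute `y_j = ∑ λ_k x_{k,j}` and pad each monomial with the missing power of
`∑ λ_k = 1`. -/
theorem exists_bernstein_expansion {n : ℕ} {p : MvPolynomial (Fin 3) ℝ} (hp : p.totalDegree ≤ n) :
    ∃ c : MultiIndex → ℝ, ∀ y, eval y p = ∑ β ∈ indexFinset n, c β * bernstein x hx n β y := by
  let Q : Fin 3 → MvPolynomial (Fin 4) ℝ := fun j => ∑ k, C (x k j) * X k
  let S : MvPolynomial (Fin 4) ℝ := ∑ k, X k
  have hQ : ∀ j, (Q j).IsHomogeneous 1 := fun j =>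
    IsHomogeneous.sum _ _ _ fun k _ => by
      simpa using (isHomogeneous_C (Fin 4) (x k j)).mul (isHomogeneous_X ℝ k)
  have hS : S.IsHomogeneous 1 := IsHomogeneous.sum _ _ _ fun k _ => isHomogeneous_X ℝ k
  let P : MvPolynomial (Fin 4) ℝ :=
    ∑ d ∈ p.support, C (coeff d p) * (∏ j, Q j ^ d j) * S ^ (n - ∑ j, d j)
  have hP : P.IsHomogeneous n := by
    refine IsHomogeneous.sum _ _ _ fun d hd => ?_
    have h1 : ∑ j, d j ≤ n := by
      have := (le_totalDegree hd).trans hp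
      rwa [Finsupp.sum_fintype _ _ (by simp)] at this
    have h2 : (∏ j, Q j ^ d j).IsHomogeneous (∑ j, d j) :=
      IsHomogeneous.prod _ _ _ fun j _ => by simpa using (hQ j).pow (d j)
    have h3 := ((isHomogeneous_C (Fin 4) (coeff d p)).mul h2).mul (hS.pow (n - ∑ j, d j))
    convert h3 using 1
    omega
  obtain ⟨c, hc⟩ := exists_bernstein_expansion_of_isHomogeneous hx hP
  refine ⟨c, fun y => ?_⟩
  rw [← hc y]
  have h1 : ∀ j, eval (fun k => bary x hx k y) (Q j) = y j := by
    intro j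
    have := congrFun (sum_bary_smul hx y) j
    simp only [Finset.sum_apply, Pi.smul_apply, smul_eq_mul] at this
    rw [← this]
    simp [Q, mul_comm]
  have h2 : eval (fun k => bary x hx k y) S = 1 := by simp [S, sum_bary]
  simp only [P, map_sum, map_mul, map_prod, map_pow, h1, h2, eval_C, one_pow, mul_one]
  exact eval_eq' y p

theorem bary_sum_smul {t : Fin 4 → ℝ} (ht : ∑ k, t k = 1) (l : Fin 4) :
    bary x hx l (∑ k, t k • x k) = t l := by
  have h0 : ∑ k, bary x hx l 0 * t k = bary x hx l 0 := by rw [← Finset.mul_sum, ht, mul_one]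
  have h1 : ∀ k, baryDeriv hx l (x k) = (if l = k then 1 else 0) - bary x hx l 0 := by
    intro k
    rw [← bary_vertex hx, bary_eq hx l (x k)]
    ring
  rw [bary_eq, map_sum]
  simp only [map_smul, h1, smul_eq_mul, mul_sub, Finset.sum_sub_distrib]
  rw [← Finset.sum_mul, ht]
  simp

/-- The Bernstein polynomials of degree `n` are linearly independent on the tetrahedron. -/
theorem eq_zero_of_sum_bernstein_eq_zero {n : ℕ} {c : MultiIndex → ℝ}
    (h : ∀ y ∈ tetra x, ∑ β ∈ indexFinset n, c β * bernstein x hx n β y = 0)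
    {β : MultiIndex} (hβ : β ∈ indexSet n) : c β = 0 := by
  let a : MultiIndex → ℝ := fun β => c β * ((n.factorial : ℝ) / (∏ k, ((β k).factorial : ℝ)))
  let P : MvPolynomial (Fin 4) ℝ :=
    ∑ β ∈ indexFinset n, monomial (Finsupp.equivFunOnFinite.symm β) (a β)
  have heval : ∀ t, eval t P = ∑ β ∈ indexFinset n, a β * ∏ k, t k ^ β k := by
    intro t
    simp only [P, map_sum, eval_monomial]
    refine Finset.sum_congr rfl fun β _ => ?_
    rw [Finsupp.prod_fintype _ _ (by simp)]
    rfl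
  -- Rescaling a positive `t` to total one gives the barycentric coordinates of a point of the
  -- tetrahedron; by homogeneity `P` vanishes at `t` too, hence on the whole positive orthant.
  have hP : P = 0 := by
    refine funext_set (fun _ => Set.Ioi (0 : ℝ)) (fun _ => Set.Ioi_infinite 0) fun t ht => ?_
    have htpos : ∀ k, 0 < t k := fun k => ht k (Set.mem_univ k)
    rw [heval, map_zero]
    set s := ∑ k, t k with hs
    have hspos : 0 < s := Finset.sum_pos (fun k _ => htpos k) Finset.univ_nonempty
    have hsum : ∑ k, t k / s = 1 := by rw [← Finset.sum_div, ← hs, div_self hspos.ne']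
    have h1 := h (∑ k, (t k / s) • x k) (by
      refine (convex_convexHull ℝ _).sum_mem (fun k _ => (div_pos (htpos k) hspos).le) hsum
        fun k _ => subset_convexHull _ _ (Set.mem_range_self k))
    have h2 : ∀ β ∈ indexFinset n, a β * ∏ k, t k ^ β k =
        s ^ n * (c β * bernstein x hx n β (∑ k, (t k / s) • x k)) := by
      intro β hβ
      have hβ' : ∑ k, β k = n := mem_indexFinset.1 hβ
      simp only [bernstein, bary_sum_smul hx hsum, div_pow, Finset.prod_div_distrib,
        Finset.prod_pow_eq_pow_sum, hβ', a]
      have := (pow_pos hspos n).ne'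
      field_simp
    rw [Finset.sum_congr rfl h2, ← Finset.mul_sum, h1, mul_zero]
  have h1 : coeff (Finsupp.equivFunOnFinite.symm β) P = a β := by
    simp only [P, coeff_sum, coeff_monomial, EmbeddingLike.apply_eq_iff_eq]
    rw [Finset.sum_ite_eq', if_pos (mem_indexFinset.2 hβ)]
  rw [hP, coeff_zero] at h1
  have h2 : (n.factorial : ℝ) / (∏ k, ((β k).factorial : ℝ)) ≠ 0 :=
    div_ne_zero (by exact_mod_cast n.factorial_ne_zero) (prod_factorial_ne_zero β)
  exact (mul_eq_zero.1 h1.symm).resolve_right h2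

/-! ### Gradients of Cartesian polynomials and Euler's operator -/

theorem hasFDerivAt_eval (p : MvPolynomial (Fin 3) ℝ) (y : R3) :
    HasFDerivAt (fun y => eval y p)
      (∑ j, eval y (pderiv j p) • (ContinuousLinearMap.proj j : R3 →L[ℝ] ℝ)) y := by
  induction p using MvPolynomial.induction_on with
  | C a => simpa using hasFDerivAt_const a y
  | add p q hp hq =>
    simp only [map_add, add_smul, Finset.sum_add_distrib]
    exact hp.add hq
  | mul_X p i hp =>
    simp only [map_mul, eval_X]
    have h := hp.mul (hasFDerivAt_apply i y)
    refine h.congr_fderiv (ContinuousLinearMap.ext fun v => ?_)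
    simp [Derivation.leibniz, pderiv_X, add_mul, Finset.sum_add_distrib, Finset.mul_sum,
      Pi.single_apply, apply_ite, mul_assoc]

theorem grad_eval (p : MvPolynomial (Fin 3) ℝ) (y : R3) (j : Fin 3) :
    grad (fun y => eval y p) y j = eval y (pderiv j p) := by
  rw [grad, (hasFDerivAt_eval p y).fderiv]
  simp [Pi.single_apply]

/-- Euler's operator multiplies a coefficient by the degree. -/
theorem coeff_sum_X_mul_pderiv (p : MvPolynomial (Fin 3) ℝ) (d : Fin 3 →₀ ℕ) :
    coeff d (∑ j, X j * pderiv j p) = (∑ j, d j : ℕ) * coeff d p := by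
  induction p using MvPolynomial.induction_on' with
  | monomial e a =>
    simp only [X_mul_pderiv_monomial]
    rw [coeff_sum]
    simp only [coeff_smul, coeff_monomial]
    split_ifs with h
    · subst h; simp [Finset.sum_mul]
    · simp
  | add p q hp hq =>
    simp only [map_add, mul_add, Finset.sum_add_distrib, coeff_add] at hp hq ⊢
    rw [hp, hq]

/-! ### Fields of given degree on the tetrahedron -/

/-- The restriction of `arrayField` to the tetrahedron. -/
def arrayFieldOn (hx : AffineIndependent ℝ x) (n : ℕ) :
    (MultiIndex → Fin 4 → ℝ) →ₗ[ℝ] (tetra x → R3) :=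
  LinearMap.funLeft ℝ R3 ((↑) : tetra x → R3) ∘ₗ arrayField hx n

theorem arrayFieldOn_apply (n : ℕ) (C : MultiIndex → Fin 4 → ℝ) (y : tetra x) :
    arrayFieldOn hx n C y = arrayField hx n C y := rfl

theorem arrayFieldOn_mem (n : ℕ) (C : MultiIndex → Fin 4 → ℝ) :
    arrayFieldOn hx n C ∈ nedelecTwo (tetra x) n := by
  intro j
  rw [mem_polySpace]
  refine ⟨∑ l, ∑ β ∈ indexFinset n,
    MvPolynomial.C (C β l * baryGrad hx l j) * bernsteinPoly hx n β, ?_, ?_⟩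
  · refine totalDegree_finsetSum_le fun l _ => totalDegree_finsetSum_le fun β hβ => ?_
    refine (totalDegree_mul _ _).trans ?_
    rw [totalDegree_C, zero_add]
    exact totalDegree_bernsteinPoly_le hx (mem_indexFinset.1 hβ)
  · intro y
    simp only [arrayFieldOn_apply, arrayField_apply, Finset.sum_apply, Pi.smul_apply, smul_eq_mul,
      map_sum, map_mul, eval_C, eval_bernsteinPoly, Finset.sum_mul]
    exact Finset.sum_congr rfl fun l _ => Finset.sum_congr rfl fun β _ => by ring

theorem eq_of_arrayFieldOn_eq_zero {n : ℕ} {C : MultiIndex → Fin 4 → ℝ}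
    (h : arrayFieldOn hx n C = 0) {β : MultiIndex} (hβ : β ∈ indexSet n) (l l' : Fin 4) :
    C β l = C β l' := by
  rw [← sub_eq_zero]
  refine eq_zero_of_sum_bernstein_eq_zero hx (c := fun β => C β l - C β l') (fun y hy => ?_) hβ
  have h0 : ∑ l, (∑ β ∈ indexFinset n, C β l * bernstein x hx n β y) • baryGrad hx l = 0 :=
    congrFun h ⟨y, hy⟩
  have h1 := eq_of_sum_smul_baryGrad_eq_zero hx h0 l l'
  simp only [sub_mul, Finset.sum_sub_distrib]
  exact sub_eq_zero.2 h1

/-- The generators `B^n_β ∇λ_l`, `l ≠ 3`, of the fields of degree `n`. -/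
def monomialField (hx : AffineIndependent ℝ x) (n : ℕ) (i : Fin 3 × indexFinset n) :
    tetra x → R3 :=
  fun y => bernstein x hx n i.2 y • baryGrad hx i.1.castSucc

/-- Edge components at `x 3` express a vector through `∇λ_0, ∇λ_1, ∇λ_2`. Dropping `∇λ_3` keeps the
generators down to `3 dim P_n`, the bound that the counting has to meet. -/
theorem nedelecTwo_le_span (n : ℕ) :
    nedelecTwo (tetra x) n ≤ Submodule.span ℝ (Set.range (monomialField hx n)) := by
  intro v hv
  choose p hp hpv using fun j => mem_polySpace.1 (hv j)
  choose c hc using fun j => exists_bernstein_expansion hx (hp j)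
  have h1 : v = ∑ l : Fin 3, ∑ β : indexFinset n,
      (∑ j, c j β * (x l.castSucc j - x 3 j)) • monomialField hx n (l, β) := by
    ext1 y
    rw [← sum_dotProduct_edge_smul_baryGrad hx (v y), Fin.sum_univ_castSucc]
    have h0 : ∑ k, v y k * (x (Fin.last 3) k - x 3 k) = 0 :=
      Finset.sum_eq_zero fun k _ => by
        rw [show Fin.last 3 = 3 from rfl, sub_self, mul_zero]
    rw [h0, zero_smul, add_zero, Finset.sum_apply]
    refine Finset.sum_congr rfl fun l _ => ?_
    simp only [Finset.sum_apply, Pi.smul_apply, monomialField, smul_smul, ← Finset.sum_smul]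
    congr 1
    rw [Finset.sum_coe_sort (indexFinset n)
      (fun β => (∑ j, c j β * (x l.castSucc j - x 3 j)) * bernstein x hx n β y)]
    simp only [hpv, hc, Finset.sum_mul]
    rw [Finset.sum_comm]
    exact Finset.sum_congr rfl fun β _ => Finset.sum_congr rfl fun j _ => by ring
  rw [h1]
  exact Submodule.sum_mem _ fun l _ => Submodule.sum_mem _ fun β _ =>
    Submodule.smul_mem _ _ (Submodule.subset_span ⟨_, rfl⟩)

include hx in
theorem finiteDimensional_nedelecTwo (n : ℕ) : FiniteDimensional ℝ (nedelecTwo (tetra x) n) := by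
  have : FiniteDimensional ℝ (Submodule.span ℝ (Set.range (monomialField hx n))) :=
    FiniteDimensional.span_of_finite ℝ (Set.finite_range _)
  exact Submodule.finiteDimensional_of_le (nedelecTwo_le_span hx n)

include hx in
theorem finrank_nedelecTwo_le (n : ℕ) :
    Module.finrank ℝ (nedelecTwo (tetra x) n) ≤ 3 * (indexFinset n).card := by
  have : FiniteDimensional ℝ (Submodule.span ℝ (Set.range (monomialField hx n))) :=
    FiniteDimensional.span_of_finite ℝ (Set.finite_range _)
  refine (Submodule.finrank_mono (nedelecTwo_le_span hx n)).trans ?_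
  refine (finrank_range_le_card (monomialField hx n)).trans ?_
  simp

/-! ### Linear independence of the family -/

instance (n : ℕ) : Fintype (nonVertexIndexSet n) :=
  ((indexFinset n).finite_toSet.subset fun _ h => mem_indexFinset.2 h.1).fintype

instance (k : ℕ) (m : Fin 4) (ρ : MultiIndex) :
    Fintype {α : MultiIndex // α ∈ faceIndexSet m k ∧ α ≠ ρ} :=
  ((indexFinset k).finite_toSet.subset (t := {α | α ∈ faceIndexSet m k ∧ α ≠ ρ})
    fun _ h => mem_indexFinset.2 h.1.1).fintype

instance (N : ℕ) : Fintype (CellBubbleIndex N) :=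
  ((Finset.univ ×ˢ indexFinset N).finite_toSet.subset (t := {p : Fin 4 × MultiIndex |
    p.2 ∈ interiorIndexSet N ∧ (p.1 = 0 ∨ p.1 = 1 ∨ (p.1 = 2 ∧ p.2 2 = 1))})
    fun _ h => Finset.mem_coe.2 (Finset.mem_product.2
      ⟨Finset.mem_univ _, mem_indexFinset.2 h.1.1⟩)).fintype

open Classical in
/-- The extension by zero of a function on a subtype. -/
def extendZero {ι : Type*} {P : ι → Prop} (c : {i // P i} → ℝ) (i : ι) : ℝ :=
  if h : P i then c ⟨i, h⟩ else 0

theorem extendZero_of_not {ι : Type*} {P : ι → Prop} (c : {i // P i} → ℝ) {i : ι} (h : ¬ P i) :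
    extendZero c i = 0 := dif_neg h

theorem extendZero_coe {ι : Type*} {P : ι → Prop} (c : {i // P i} → ℝ) (i : {i // P i}) :
    extendZero c i.1 = c i := dif_pos i.2

theorem sum_subtype_eq_sum_extendZero {ι : Type*} {P : ι → Prop} [Fintype {i // P i}]
    {s : Finset ι} (hs : ∀ i, P i → i ∈ s) (c : {i // P i} → ℝ) (φ : ι → ℝ) :
    ∑ i, c i * φ i.1 = ∑ i ∈ s, extendZero c i * φ i := by
  refine Finset.sum_bij_ne_zero (fun i _ _ => i.1) (fun i _ _ => hs _ i.2)
    (fun i _ _ j _ _ h => Subtype.ext h) (fun i _ h => ?_) (fun i _ _ => ?_)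
  · by_cases hi : P i
    · exact ⟨⟨i, hi⟩, Finset.mem_univ _, by rwa [← extendZero_coe c], rfl⟩
    · simp [extendZero_of_not c hi] at h
  · rw [extendZero_coe]

/-- The coefficient arrays of the basis functions in degree `k + 1`. -/
def curlArray (σ : Fin 4 → Equiv.Perm (Fin 4)) (k : ℕ) (r : Fin 4 → MultiIndex) :
    CurlIndex (k + 1) k r → MultiIndex → Fin 4 → ℝ
  | .inl e => whitneyArray (k + 1) e.1.1 e.1.2
  | .inr (.inl α) => gradArray (k + 1) α.1
  | .inr (.inr (.inl f)) => faceArray (σ f.1) f.2.1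
  | .inr (.inr (.inr c)) => cellArray (k + 1) c.1.1 c.1.2

theorem curlFamily_eq_arrayFieldOn (σ : Fin 4 → Equiv.Perm (Fin 4)) (k : ℕ)
    (r : Fin 4 → MultiIndex) (i : CurlIndex (k + 1) k r) :
    curlFamily x hx σ (k + 1) k r i = arrayFieldOn hx (k + 1) (curlArray σ k r i) := by
  ext1 y
  rw [arrayFieldOn_apply]
  match i with
  | .inl e => exact congrFun (whitney_eq_arrayField hx (Nat.succ_ne_zero k) _ _) y
  | .inr (.inl α) => exact congrFun (grad_bernstein hx α.2.1) y
  | .inr (.inr (.inl f)) => exact congrFun (faceBubble_eq_arrayField hx f.2.2.1.1 _) y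
  | .inr (.inr (.inr c)) =>
    exact congrFun (cellBubble_eq_arrayField hx c.2.1.1 (c.2.1.2 _).ne') y

/-- Extending the coefficients by zero turns the index restrictions of the family into the vanishing
hypotheses of `coefficients_eq_zero`. -/
theorem sum_curlArray (σ : Fin 4 → Equiv.Perm (Fin 4)) (k : ℕ) (r : Fin 4 → MultiIndex)
    (c : CurlIndex (k + 1) k r → ℝ) {β : MultiIndex} (hβ : β ∈ indexSet (k + 1)) (l : Fin 4) :
    ∑ i, c i * curlArray σ k r i β l = totalArray σ k (fun e => c (.inl e))
      (extendZero fun α => c (.inr (.inl α)))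
      (fun m => extendZero fun α => c (.inr (.inr (.inl ⟨m, α⟩))))
      (fun l α => extendZero (fun p => c (.inr (.inr (.inr p)))) (l, α)) β l := by
  rw [Fintype.sum_sum_type, Fintype.sum_sum_type, Fintype.sum_sum_type, Fintype.sum_sigma,
    totalArray, ← add_assoc, ← add_assoc]
  have hmem : β + unitIndex l ∈ indexFinset (k + 2) :=
    mem_indexFinset.2 ((add_unitIndex_mem l).2 hβ)
  congr 1
  · congr 1
    · congr 1
      · refine (sum_subtype_eq_sum_extendZero (s := indexFinset (k + 2))
          (fun α h => mem_indexFinset.2 h.1) (fun α => c (.inr (.inl α)))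
          (fun α => gradArray (k + 1) α β l)).trans ?_
        simp only [gradArray, mul_ite, mul_zero]
        rw [Finset.sum_ite_eq', if_pos hmem]
        push_cast
        ring
    · refine Finset.sum_congr rfl fun m _ => ?_
      exact sum_subtype_eq_sum_extendZero (s := indexFinset k)
        (fun α h => mem_indexFinset.2 h.1.1) (fun α => c (.inr (.inr (.inl ⟨m, α⟩))))
        (fun α => faceArray (σ m) α β l)
  · refine (sum_subtype_eq_sum_extendZero (s := Finset.univ ×ˢ indexFinset (k + 2))
      (fun p h => Finset.mem_product.2 ⟨Finset.mem_univ _, mem_indexFinset.2 h.1.1⟩)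
      (fun p => c (.inr (.inr (.inr p)))) (fun p => cellArray (k + 1) p.1 p.2 β l)).trans ?_
    rw [Finset.sum_product]
    simp only [cellArray, mul_ite, mul_zero]
    simp only [Finset.sum_ite_eq', if_pos hmem, mul_sub, Finset.sum_sub_distrib, mul_ite, mul_zero,
      Finset.sum_ite_eq, Finset.mem_univ, if_true]
    push_cast
    ring

theorem linearIndependent_curlFamily {σ : Fin 4 → Equiv.Perm (Fin 4)} (hσ : ∀ m, σ m 3 = m)
    (k : ℕ) {r : Fin 4 → MultiIndex} (hr : ∀ m, r m ∈ faceIndexSet m k) :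
    LinearIndependent ℝ (curlFamily x hx σ (k + 1) k r) := by
  rw [Fintype.linearIndependent_iff]
  intro c hc
  have h1 : arrayFieldOn hx (k + 1) (∑ i, c i • curlArray σ k r i) = 0 := by
    simp only [map_sum, map_smul, ← curlFamily_eq_arrayFieldOn]
    exact hc
  have hT : ∀ β ∈ indexSet (k + 1), ∀ l l',
      totalArray σ k (fun e => c (.inl e))
      (extendZero fun α => c (.inr (.inl α)))
      (fun m => extendZero fun α => c (.inr (.inr (.inl ⟨m, α⟩))))
      (fun l α => extendZero (fun p => c (.inr (.inr (.inr p)))) (l, α)) β l =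
      totalArray σ k (fun e => c (.inl e))
      (extendZero fun α => c (.inr (.inl α)))
      (fun m => extendZero fun α => c (.inr (.inr (.inl ⟨m, α⟩))))
      (fun l α => extendZero (fun p => c (.inr (.inr (.inr p)))) (l, α)) β l' := by
    intro β hβ l l'
    rw [← sum_curlArray σ k r c hβ l, ← sum_curlArray σ k r c hβ l']
    have := eq_of_arrayFieldOn_eq_zero hx h1 hβ l l'
    simpa only [Finset.sum_apply, Pi.smul_apply, smul_eq_mul] using this
  obtain ⟨hw, hg, hf, hh⟩ := coefficients_eq_zero
    (fun α h => extendZero_of_not _ h)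
    (fun m α h => extendZero_of_not _ fun h' => h h'.1) hr
    (fun m => extendZero_of_not _ fun h' => h'.2 rfl)
    (fun l α h => extendZero_of_not _ fun h' => h h'.1)
    (fun α => extendZero_of_not _ fun h' => by simp at h')
    (fun α h => extendZero_of_not _ fun h' => h (by simpa using h'.2)) hσ hT
  intro i
  match i with
  | .inl e => exact hw e
  | .inr (.inl α) => exact (extendZero_coe _ α).symm.trans (hg α)
  | .inr (.inr (.inl ⟨m, α⟩)) =>
    exact (extendZero_coe (fun α => c (.inr (.inr (.inl ⟨m, α⟩)))) α).symm.trans (hf m α)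
  | .inr (.inr (.inr p)) =>
    exact (extendZero_coe (fun p => c (.inr (.inr (.inr p)))) p).symm.trans (hh p.1.1 p.1.2)

/-! ### Counting the basis functions -/

theorem card_indexFinset (n : ℕ) : 6 * (indexFinset n).card = (n + 1) * (n + 2) * (n + 3) := by
  have h1 : (indexFinset n).card = (n + 3).choose 3 := by
    rw [indexFinset, ← Finset.map_sym_eq_piAntidiag, Finset.card_map, Finset.sym_univ,
      Finset.card_univ, Sym.card_sym_eq_choose, Fintype.card_fin,
      show 4 + n - 1 = n + 3 by omega, Nat.choose_symm_add]
  have h2 := Nat.descFactorial_eq_factorial_mul_choose (n + 3) 3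
  simp [Nat.descFactorial, Nat.factorial] at h2
  rw [h1, ← h2]
  ring

theorem card_filter_ne_zero (n : ℕ) (m : Fin 4) :
    ((indexFinset (n + 1)).filter fun α => ¬ α m = 0).card = (indexFinset n).card := by
  symm
  refine Finset.card_bij (fun α _ => α + unitIndex m) (fun α hα => ?_)
    (fun _ _ _ _ h => add_right_cancel h) (fun α hα => ?_)
  · rw [Finset.mem_filter, mem_indexFinset]
    exact ⟨(add_unitIndex_mem m).2 (mem_indexFinset.1 hα), by simp⟩
  · rw [Finset.mem_filter, mem_indexFinset] at hα
    obtain ⟨β, rfl⟩ := exists_eq_add_unitIndex hα.2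
    exact ⟨β, mem_indexFinset.2 ((add_unitIndex_mem m).1 hα.1), rfl⟩

theorem card_face (n : ℕ) (m : Fin 4) :
    2 * ((indexFinset n).filter fun α => α m = 0).card = (n + 1) * (n + 2) := by
  cases n with
  | zero =>
    have : (indexFinset 0).filter (fun α => α m = 0) = {0} := by
      simp [indexFinset, Finset.filter_singleton]
    rw [this]
    rfl
  | succ n =>
    have h1 := Finset.card_filter_add_card_filter_not (s := indexFinset (n + 1))
      (fun α : MultiIndex => α m = 0)
    rw [card_filter_ne_zero] at h1
    have h2 := card_indexFinset n
    have h3 := card_indexFinset (n + 1)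
    nlinarith

theorem card_nonVertexIndexSet (n : ℕ) (hn : n ≠ 0) :
    Fintype.card (nonVertexIndexSet n) + 4 = (indexFinset n).card := by
  have hinj : Function.Injective (fun l : Fin 4 => n • unitIndex l) := by
    intro l l' h
    by_contra hne
    have := congrFun h l
    simp [hne, hn] at this
  have h1 : Fintype.card (nonVertexIndexSet n) =
      (indexFinset n \ Finset.univ.image fun l : Fin 4 => n • unitIndex l).card := by
    refine Fintype.card_of_subtype _ fun α => ?_
    simp [mem_indexFinset, nonVertexIndexSet, eq_comm]
  have h2 : Finset.univ.image (fun l : Fin 4 => n • unitIndex l) ⊆ indexFinset n := by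
    intro α hα
    obtain ⟨l, -, rfl⟩ := Finset.mem_image.1 hα
    rw [mem_indexFinset]
    simp [indexSet, ← Finset.mul_sum]
  have h3 := Finset.card_sdiff_add_card_eq_card h2
  rw [Finset.card_image_of_injective _ hinj] at h3
  rw [h1, ← h3]
  rfl

theorem card_faceBubbleIndex (k : ℕ) {r : Fin 4 → MultiIndex}
    (hr : ∀ m, r m ∈ faceIndexSet m k) :
    Fintype.card (FaceBubbleIndex k r) + 4 = 2 * ((k + 1) * (k + 2)) := by
  have h1 : ∀ m, 2 * (Fintype.card {α : MultiIndex // α ∈ faceIndexSet m k ∧ α ≠ r m} + 1) =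
      (k + 1) * (k + 2) := by
    intro m
    have h2 : Fintype.card {α : MultiIndex // α ∈ faceIndexSet m k ∧ α ≠ r m} =
        (((indexFinset k).filter fun α => α m = 0).erase (r m)).card := by
      refine Fintype.card_of_subtype _ fun α => ?_
      simp [mem_indexFinset, faceIndexSet, and_comm]
    rw [h2, Finset.card_erase_add_one, card_face]
    rw [Finset.mem_filter, mem_indexFinset]
    exact hr m
  rw [Fintype.card_sigma, Fin.sum_univ_four]
  have := h1 0; have := h1 1; have := h1 2; have := h1 3
  omega

/-- Subtract one from each entry. The condition `hp` covers both uses: `p` always true, and `p a`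
meaning `a = 1`. -/
theorem card_interior (k : ℕ) (p : ℕ → Prop) [DecidablePred p] (hp : ∀ a, p (a + 1) ↔ a = 0 ∨ p 0) :
    ((indexFinset (k + 4)).filter fun α => (∀ l, 0 < α l) ∧ p (α 2)).card =
      ((indexFinset k).filter fun α => α 2 = 0 ∨ p 0).card := by
  symm
  refine Finset.card_bij (fun α _ => α + 1) (fun α hα => ?_)
    (fun _ _ _ _ h => add_right_cancel h) (fun α hα => ?_)
  · rw [Finset.mem_filter, mem_indexFinset] at hα ⊢
    refine ⟨?_, fun l => Nat.succ_pos _, (hp _).2 hα.2⟩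
    have := hα.1
    simp [indexSet, Finset.sum_add_distrib] at this ⊢
    exact this
  · rw [Finset.mem_filter, mem_indexFinset] at hα
    obtain ⟨h1, h2, h3⟩ := hα
    have h4 : α = (α - 1) + 1 := by
      funext l
      have := h2 l
      simp
      omega
    refine ⟨α - 1, ?_, h4.symm⟩
    rw [h4] at h1 h3
    rw [Finset.mem_filter, mem_indexFinset]
    refine ⟨?_, (hp _).1 h3⟩
    simp [indexSet, Finset.sum_add_distrib] at h1 ⊢
    exact h1

theorem card_cellBubbleIndex (k : ℕ) :
    6 * Fintype.card (CellBubbleIndex (k + 4)) =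
      2 * ((k + 1) * (k + 2) * (k + 3)) + 3 * ((k + 1) * (k + 2)) := by
  have h1 : Fintype.card (CellBubbleIndex (k + 4)) = ((({0, 1} : Finset (Fin 4)) ×ˢ
      (indexFinset (k + 4)).filter fun α => (∀ l, 0 < α l) ∧ True).disjUnion
      (({2} : Finset (Fin 4)) ×ˢ
      (indexFinset (k + 4)).filter fun α => (∀ l, 0 < α l) ∧ α 2 = 1) (by
        rw [Finset.disjoint_left]
        rintro ⟨a, α⟩ h h'
        simp only [Finset.mem_product, Finset.mem_insert, Finset.mem_singleton] at h h'
        rw [h'.1] at h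
        revert h
        simp)).card := by
    refine Fintype.card_of_subtype _ fun p => ?_
    simp only [Finset.mem_disjUnion, Finset.mem_product, Finset.mem_insert, Finset.mem_singleton,
      Finset.mem_filter, mem_indexFinset, interiorIndexSet, Set.mem_ofPred_eq]
    tauto
  rw [h1, Finset.card_disjUnion, Finset.card_product, Finset.card_product,
    card_interior k (fun _ => True) (by simp), card_interior k (fun a => a = 1) (by simp)]
  have h2 := card_indexFinset k
  have h3 := card_face k 2
  simp only [or_true, Finset.filter_true, zero_ne_one, or_false, Finset.card_singleton]
  rw [Finset.card_pair (by decide)]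
  omega

theorem card_curlIndex (k : ℕ) {r : Fin 4 → MultiIndex} (hr : ∀ m, r m ∈ faceIndexSet m k) :
    3 * (indexFinset (k + 1)).card ≤ Fintype.card (CurlIndex (k + 1) k r) := by
  have h0 : Fintype.card EdgeIndex = 6 := by decide
  rw [Fintype.card_sum, Fintype.card_sum, Fintype.card_sum, h0]
  have h1 := card_nonVertexIndexSet (k + 1 + 1) (by omega)
  have h2 := card_faceBubbleIndex k hr
  have h3 := card_indexFinset (k + 1)
  have h4 := card_indexFinset (k + 1 + 1)
  -- For `k < 2` the edges, gradients and face bubbles already reach the bound; an interior index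
  -- needs weight at least four.
  match k with
  | 0 => omega
  | 1 => omega
  | k + 2 =>
    have h5 := card_cellBubbleIndex k
    have h6 : CellBubbleIndex (k + 2 + 2) = CellBubbleIndex (k + 4) := rfl
    nlinarith

/-- The second-kind basis. -/
theorem isBasisOf_nedelecTwo {σ : Fin 4 → Equiv.Perm (Fin 4)} (hσ : ∀ m, σ m 3 = m)
    (k : ℕ) {r : Fin 4 → MultiIndex} (hr : ∀ m, r m ∈ faceIndexSet m k) :
    IsBasisOf (curlFamily x hx σ (k + 1) k r) (nedelecTwo (tetra x) (k + 1)) := by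
  have hli := linearIndependent_curlFamily hx hσ k hr
  refine ⟨hli, ?_⟩
  have := finiteDimensional_nedelecTwo hx (k + 1)
  refine Submodule.eq_of_le_of_finrank_le ?_ ?_
  · rw [Submodule.span_le]
    rintro _ ⟨i, rfl⟩
    rw [curlFamily_eq_arrayFieldOn]
    exact arrayFieldOn_mem hx (k + 1) _
  · rw [finrank_span_eq_card hli]
    exact (finrank_nedelecTwo_le hx (k + 1)).trans (card_curlIndex k hr)

/-! ### The first-kind space -/

theorem exists_of_mem_crossHom {K : Set R3} {n : ℕ} {v : K → R3} (hv : v ∈ crossHom K n) :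
    ∃ w : K → R3, (∀ y, v y = crossProduct (y : R3) (w y)) ∧
      ∃ p : Fin 3 → MvPolynomial (Fin 3) ℝ, (∀ j, (p j).IsHomogeneous (n + 1)) ∧
        ∀ y : K, ∀ j, v y j = eval (y : R3) (p j) := by
  obtain ⟨w, hw, rfl⟩ := hv
  refine ⟨w, fun y => rfl, ?_⟩
  choose q hq hqw using fun j => mem_homPolySpace.1 (hw j)
  have hX : ∀ i j, (X i * q j : MvPolynomial (Fin 3) ℝ).IsHomogeneous (n + 1) := fun i j => by
    simpa [add_comm] using (isHomogeneous_X ℝ i).mul (hq j)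
  refine ⟨![X 1 * q 2 - X 2 * q 1, X 2 * q 0 - X 0 * q 2, X 0 * q 1 - X 1 * q 0], ?_, ?_⟩
  · intro j
    fin_cases j <;> exact (hX _ _).sub (hX _ _)
  · intro y j
    change crossProduct (y : R3) (w y) j = _
    rw [cross_apply]
    fin_cases j <;> simp [hqw]

-- The components of `x × q` are homogeneous of degree `n + 1`, so they cannot have degree at most
-- `n` unless they are zero.
include hx in
theorem disjoint_nedelecTwo_crossHom (n : ℕ) :
    Disjoint (nedelecTwo (tetra x) n) (crossHom (tetra x) n) := by
  rw [Submodule.disjoint_def]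
  intro v hv hv'
  obtain ⟨-, -, p, hp, hpv⟩ := exists_of_mem_crossHom hv'
  ext y j
  obtain ⟨q, hq, hqv⟩ := mem_polySpace.1 (hv j)
  have h1 : p j = q := polyEval_injective hx <| by
    ext y
    exact (hpv y j).symm.trans (hqv y)
  have h2 : p j = 0 := by
    by_contra h0
    have := (hp j).totalDegree h0
    rw [h1] at this
    omega
  rw [hpv, h2]
  simp

theorem polySpace_mono (K : Set R3) {m n : ℕ} (h : m ≤ n) : polySpace K m ≤ polySpace K n := by
  intro f hf
  rw [mem_polySpace] at hf ⊢
  obtain ⟨p, hp, hpf⟩ := hf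
  exact ⟨p, hp.trans h, hpf⟩

theorem nedelecOne_le_nedelecTwo (K : Set R3) (n : ℕ) : nedelecOne K n ≤ nedelecTwo K (n + 1) := by
  refine sup_le (fun v hv j => polySpace_mono K n.le_succ (hv j)) fun v hv j => ?_
  obtain ⟨-, -, p, hp, hpv⟩ := exists_of_mem_crossHom hv
  exact mem_polySpace.2 ⟨p j, (hp j).totalDegree_le, fun y => hpv y j⟩

/-- Fields of the first kind have a radial component of degree at most `n + 1`. -/
theorem exists_dotProduct_of_mem_nedelecOne {K : Set R3} {n : ℕ} {v : K → R3}
    (hv : v ∈ nedelecOne K n) : ∃ q : MvPolynomial (Fin 3) ℝ, q.totalDegree ≤ n + 1 ∧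
      ∀ y : K, ∑ j, (y : R3) j * v y j = eval (y : R3) q := by
  obtain ⟨u, hu, c, hc, rfl⟩ := Submodule.mem_sup.1 hv
  obtain ⟨w, hw, -⟩ := exists_of_mem_crossHom hc
  choose p hp hpu using fun j => mem_polySpace.1 (hu j)
  refine ⟨∑ j, X j * p j, totalDegree_finsetSum_le fun j _ => ?_, fun y => ?_⟩
  · refine (totalDegree_mul _ _).trans ?_
    rw [totalDegree_X]
    have := hp j
    omega
  · have h1 : ∑ j, (y : R3) j * c y j = 0 := by
      rw [hw]
      exact dot_self_cross (y : R3) (w y)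
    simp only [Pi.add_apply, mul_add, Finset.sum_add_distrib, h1, add_zero, hpu]
    simp

/-! ### Whitney forms and bubbles as fields of the first kind -/

theorem mem_nedelecTwo_of_eval {K : Set R3} {n : ℕ} {v : K → R3}
    (p : Fin 3 → MvPolynomial (Fin 3) ℝ) (hp : ∀ j, (p j).totalDegree ≤ n)
    (h : ∀ y : K, ∀ j, v y j = eval (y : R3) (p j)) : v ∈ nedelecTwo K n :=
  fun j => mem_polySpace.2 ⟨p j, hp j, fun y => h y j⟩

/-- Split each `λ` into its linear part and its value at the origin; the linear parts combine by the
triple product identity. -/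
theorem whitney_eq_cross (i j : Fin 4) (y : R3) :
    whitney x hx i j y = (bary x hx i 0 • baryGrad hx j - bary x hx j 0 • baryGrad hx i) +
      crossProduct y (crossProduct (baryGrad hx j) (baryGrad hx i)) := by
  rw [whitney, grad_bary, grad_bary, bary_eq hx i y, bary_eq hx j y, baryDeriv_eq_dotProduct,
    baryDeriv_eq_dotProduct]
  simp only [cross_apply]
  ext a
  fin_cases a <;> simp [Fin.sum_univ_three] <;> ring

/-- In top degree `i = n` the field has the form `x × q̃`; in lower degree its components have
degree `i + 1 ≤ n`. -/
theorem smul_cross_mem_nedelecOne (K : Set R3) {n i : ℕ} {q : MvPolynomial (Fin 3) ℝ}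
    (hq : q.IsHomogeneous i) (hi : i ≤ n) (c : R3) :
    (fun y : K => eval (y : R3) q • crossProduct (y : R3) c) ∈ nedelecOne K n := by
  have hmem : (fun y : K => eval (y : R3) q • crossProduct (y : R3) c) ∈ crossHom K i := by
    refine ⟨fun y => eval (y : R3) q • c, fun j => ?_, ?_⟩
    · refine mem_homPolySpace.2 ⟨q * C (c j), ?_, fun y => by simp⟩
      simpa using hq.mul (isHomogeneous_C (Fin 3) (c j))
    · ext1 y
      simp [crossPosition]
  rcases hi.eq_or_lt with rfl | hlt
  · exact Submodule.mem_sup_right hmem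
  · obtain ⟨-, -, p, hp, hpv⟩ := exists_of_mem_crossHom hmem
    exact Submodule.mem_sup_left (mem_nedelecTwo_of_eval p
      (fun j => (hp j).totalDegree_le.trans hlt) hpv)

/-- Polynomials of degree at most `n` times Whitney forms are fields of the first kind. -/
theorem smul_whitney_mem_nedelecOne {n : ℕ} {q : MvPolynomial (Fin 3) ℝ} (hq : q.totalDegree ≤ n)
    (i j : Fin 4) :
    (fun y : tetra x => eval (y : R3) q • whitney x hx i j y) ∈ nedelecOne (tetra x) n := by
  set a : R3 := bary x hx i 0 • baryGrad hx j - bary x hx j 0 • baryGrad hx i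
  set c : R3 := crossProduct (baryGrad hx j) (baryGrad hx i)
  have h1 : (fun y : tetra x => eval (y : R3) q • whitney x hx i j y) =
      (fun y : tetra x => eval (y : R3) q • a) + ∑ d ∈ Finset.range (q.totalDegree + 1),
        fun y : tetra x => eval (y : R3) (homogeneousComponent d q) • crossProduct (y : R3) c := by
    ext1 y
    rw [Pi.add_apply, Finset.sum_apply, ← Finset.sum_smul, ← map_sum, sum_homogeneousComponent,
      whitney_eq_cross, smul_add]
  rw [h1]
  refine Submodule.add_mem _ (Submodule.mem_sup_left ?_) (Submodule.sum_mem _ fun d hd => ?_)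
  · refine mem_nedelecTwo_of_eval (fun k => q * C (a k)) (fun k => ?_) fun y k => by simp
    refine (totalDegree_mul _ _).trans ?_
    rw [totalDegree_C, add_zero]
    exact hq
  · refine smul_cross_mem_nedelecOne _ (homogeneousComponent_isHomogeneous d q) ?_ c
    have := Finset.mem_range.1 hd
    omega

theorem bernstein_smul_whitney_mem {n : ℕ} {α : MultiIndex} (hα : α ∈ indexSet n) (a : ℝ)
    (i j : Fin 4) :
    (fun y : tetra x => (a * bernstein x hx n α y) • whitney x hx i j y) ∈
      nedelecOne (tetra x) n := by
  have := smul_whitney_mem_nedelecOne hx (q := C a * bernsteinPoly hx n α)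
    ((totalDegree_mul _ _).trans (by simpa using totalDegree_bernsteinPoly_le hx hα)) i j
  simpa [eval_bernsteinPoly] using this

theorem faceBubble_mem_nedelecOne {n : ℕ} {α : MultiIndex} (hα : α ∈ indexSet n)
    (s : Equiv.Perm (Fin 4)) :
    (fun y : tetra x => faceBubble x hx s n α y) ∈ nedelecOne (tetra x) n := by
  have h := fun (a : ℝ) => bernstein_smul_whitney_mem hx hα (((n : ℝ) + 1) * a)
  have := Submodule.add_mem _ (Submodule.add_mem _ (h (α (s 0)) (s 1) (s 2))
    (h (α (s 1)) (s 2) (s 0))) (h (α (s 2)) (s 0) (s 1))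
  convert this using 1
  ext1 y
  simp only [faceBubble, smul_add, smul_smul, Pi.add_apply]
  refine congrArg₂ (· + ·) (congrArg₂ (· + ·) ?_ ?_) ?_ <;>
  · congr 1
    ring

/-- The cell bubbles as combinations of Whitney forms. -/
theorem cellBubble_eq_sum_whitney {n : ℕ} {α : MultiIndex} (hα : α ∈ interiorIndexSet (n + 2))
    (l : Fin 4) (y : R3) : cellBubble x hx (n + 1) l α y = ∑ m ∈ Finset.univ.erase l,
      (((n : ℝ) + 1) * bernstein x hx n (α - unitIndex l - unitIndex m) y) •
        whitney x hx m l y := by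
  have hterm : ∀ m ∈ Finset.univ.erase l,
      (((n : ℝ) + 1) * bernstein x hx n (α - unitIndex l - unitIndex m) y) • whitney x hx m l y =
      (α m * bernstein x hx (n + 1) (α - unitIndex l) y) • baryGrad hx l -
      (α l * bernstein x hx (n + 1) (α - unitIndex m) y) • baryGrad hx m := by
    intro m hm
    have hml : m ≠ l := Finset.ne_of_mem_erase hm
    obtain ⟨β, rfl⟩ := exists_eq_add_unitIndex (α := α) (l := l) (hα.2 l).ne'
    obtain ⟨γ, rfl⟩ := exists_eq_add_unitIndex (α := β) (l := m) (by
      have := hα.2 m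
      simp [hml] at this
      omega)
    have e1 : γ + unitIndex m + unitIndex l - unitIndex m = γ + unitIndex l := by
      rw [add_right_comm, add_tsub_cancel_right]
    rw [add_tsub_cancel_right, add_tsub_cancel_right, e1, whitney, grad_bary, grad_bary]
    have h1 := bary_mul_bernstein hx n γ m y
    have h2 := bary_mul_bernstein hx n γ l y
    have e2 : ((γ + unitIndex m + unitIndex l) m : ℝ) = γ m + 1 := by simp [hml]
    have e3 : ((γ + unitIndex m + unitIndex l) l : ℝ) = γ l + 1 := by simp [hml.symm]
    rw [e2, e3, ← h1, ← h2, smul_sub, smul_smul, smul_smul]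
  have hgrad : grad (bernstein x hx (n + 1 + 1) α) y =
      ∑ m, (((n : ℝ) + 2) * bernstein x hx (n + 1) (α - unitIndex m) y) • baryGrad hx m := by
    rw [grad_bernstein hx hα.1, arrayField_apply]
    refine Finset.sum_congr rfl fun m _ => ?_
    obtain ⟨β, rfl⟩ := exists_eq_add_unitIndex (α := α) (l := m) (hα.2 m).ne'
    simp only [ite_mul, zero_mul]
    rw [sum_ite_eq_add_unitIndex ((add_unitIndex_mem m).1 hα.1), add_tsub_cancel_right]
    push_cast
    congr 2
    ring
  rw [Finset.sum_congr rfl hterm, Finset.sum_sub_distrib, ← Finset.sum_smul, ← Finset.sum_mul,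
    cellBubble, hgrad, grad_bary, ← Finset.add_sum_erase _ _ (Finset.mem_univ l)]
  -- This is the coefficient of `B_{α - e_l} ∇λ_l` left in the cell bubble after the gradient term
  -- is subtracted.
  have hsum : ∑ m ∈ Finset.univ.erase l, (α m : ℝ) = n + 2 - α l := by
    have h1 : ∑ m, α m = n + 2 := hα.1
    rw [← Finset.add_sum_erase _ _ (Finset.mem_univ l)] at h1
    have : (α l : ℝ) + ∑ m ∈ Finset.univ.erase l, (α m : ℝ) = n + 2 := by exact_mod_cast h1
    linarith
  have hn : (n : ℝ) + 2 ≠ 0 := by positivity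
  rw [hsum, smul_add, Finset.smul_sum, ← sub_sub]
  push_cast
  rw [show (n : ℝ) + 1 + 1 = n + 2 by ring]
  congr 1
  · rw [smul_smul, ← sub_smul]
    congr 1
    field_simp
  · refine Finset.sum_congr rfl fun m _ => ?_
    rw [smul_smul]
    congr 1
    field_simp

theorem cellBubble_mem_nedelecOne {n : ℕ} {α : MultiIndex} (hα : α ∈ interiorIndexSet (n + 2))
    (l : Fin 4) :
    (fun y : tetra x => cellBubble x hx (n + 1) l α y) ∈ nedelecOne (tetra x) n := by
  have h1 : (fun y : tetra x => cellBubble x hx (n + 1) l α y) =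
      ∑ m ∈ Finset.univ.erase l, fun y : tetra x =>
        (((n : ℝ) + 1) * bernstein x hx n (α - unitIndex l - unitIndex m) y) •
          whitney x hx m l y := by
    ext1 y
    rw [Finset.sum_apply]
    exact cellBubble_eq_sum_whitney hx hα l y
  rw [h1]
  refine Submodule.sum_mem _ fun m hm => bernstein_smul_whitney_mem hx ?_ _ m l
  have hml : m ≠ l := Finset.ne_of_mem_erase hm
  obtain ⟨β, rfl⟩ := exists_eq_add_unitIndex (α := α) (l := l) (hα.2 l).ne'
  obtain ⟨γ, rfl⟩ := exists_eq_add_unitIndex (α := β) (l := m) (by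
    have := hα.2 m
    simp [hml] at this
    omega)
  rw [add_tsub_cancel_right, add_tsub_cancel_right]
  exact (add_unitIndex_mem m).1 ((add_unitIndex_mem l).1 hα.1)

/-! ### Gradients of polynomials that vanish at the vertices -/

/-- The gradients of the non-vertex Bernstein polynomials of degree `N`. -/
def gradFamily (hx : AffineIndependent ℝ x) (N : ℕ) (α : nonVertexIndexSet N) : tetra x → R3 :=
  fun y => grad (bernstein x hx N α.1) y

theorem bernstein_vertex_of_ne {n : ℕ} {α : MultiIndex} (hα : α ∈ indexSet n) {l : Fin 4}
    (hne : α ≠ n • unitIndex l) : bernstein x hx n α (x l) = 0 := by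
  obtain ⟨k, hk, hk'⟩ : ∃ k, k ≠ l ∧ α k ≠ 0 := by
    by_contra! hcon
    apply hne
    have h1 : ∑ k, α k = n := hα
    rw [Finset.sum_eq_single l (fun k _ hk => hcon k hk) (by simp)] at h1
    funext k
    rcases eq_or_ne k l with rfl | hk
    · simp [h1]
    · simp [hcon k hk, hk]
  have h0 : ∏ k, bary x hx k (x l) ^ α k = 0 := Finset.prod_eq_zero (Finset.mem_univ k) (by
    rw [bary_vertex, if_neg hk, zero_pow hk'])
  rw [bernstein, h0, mul_zero]

theorem bernstein_vertex_self (n : ℕ) (l : Fin 4) :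
    bernstein x hx n (n • unitIndex l) (x l) = 1 := by
  have h1 : ∏ k, (((n • unitIndex l) k).factorial : ℝ) = n.factorial := by
    rw [Finset.prod_eq_single l]
    · simp
    · intro k _ hk; simp [hk]
    · simp
  have h2 : ∏ k, bary x hx k (x l) ^ (n • unitIndex l) k = 1 := by
    refine Finset.prod_eq_one fun k _ => ?_
    rcases eq_or_ne k l with rfl | hk
    · simp [bary_vertex]
    · simp [hk]
  rw [bernstein, h1, h2, mul_one, div_self]
  exact_mod_cast n.factorial_ne_zero

/-- The Bernstein coefficient at a vertex index is the value of `p` at that vertex, so only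
non-vertex terms survive. Together with its converse this describes the span without reference to
Bernstein polynomials, which makes spans of different degrees comparable. -/
theorem grad_mem_span_gradFamily {N : ℕ} {p : MvPolynomial (Fin 3) ℝ}
    (hp : p.totalDegree ≤ N) (hv : ∀ l, eval (x l) p = 0) :
    (fun y : tetra x => grad (fun z => eval z p) y) ∈
      Submodule.span ℝ (Set.range (gradFamily hx N)) := by
  obtain ⟨c, hc⟩ := exists_bernstein_expansion hx hp
  have hc0 : ∀ l, c (N • unitIndex l) = 0 := by
    intro l
    have h1 := hc (x l)
    rw [hv, Finset.sum_eq_single (N • unitIndex l), bernstein_vertex_self, mul_one] at h1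
    · exact h1.symm
    · intro β hβ hne
      rw [bernstein_vertex_of_ne hx (mem_indexFinset.1 hβ) hne, mul_zero]
    · intro h
      refine absurd (mem_indexFinset.2 ?_) h
      simp [indexSet, ← Finset.mul_sum]
  have hp' : p = ∑ β ∈ indexFinset N, C (c β) * bernsteinPoly hx N β := by
    refine MvPolynomial.funext fun y => ?_
    rw [hc]
    simp [eval_bernsteinPoly]
  have h2 : (fun y : tetra x => grad (fun z => eval z p) y) =
      ∑ β ∈ indexFinset N, c β • fun y : tetra x => grad (bernstein x hx N β) y := by
    ext y j
    rw [grad_eval, hp']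
    simp only [map_sum, pderiv_C_mul, Finset.sum_apply, Pi.smul_apply, smul_eq_mul, map_mul, eval_C]
    refine Finset.sum_congr rfl fun β _ => ?_
    rw [← grad_eval]
    simp only [eval_bernsteinPoly]
  rw [h2]
  refine Submodule.sum_mem _ fun β hβ => ?_
  by_cases h : β ∈ nonVertexIndexSet N
  · exact Submodule.smul_mem _ _ (Submodule.subset_span ⟨⟨β, h⟩, rfl⟩)
  · obtain ⟨l, rfl⟩ : ∃ l, β = N • unitIndex l := by
      by_contra! hcon
      exact h ⟨mem_indexFinset.1 hβ, hcon⟩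
    rw [hc0, zero_smul]
    exact Submodule.zero_mem _

theorem exists_of_mem_span_gradFamily {N : ℕ} {v : tetra x → R3}
    (hv : v ∈ Submodule.span ℝ (Set.range (gradFamily hx N))) :
    ∃ p : MvPolynomial (Fin 3) ℝ, p.totalDegree ≤ N ∧ (∀ l, eval (x l) p = 0) ∧
      v = fun y : tetra x => grad (fun z => eval z p) y := by
  induction hv using Submodule.span_induction with
  | mem v hv =>
    obtain ⟨α, rfl⟩ := hv
    refine ⟨bernsteinPoly hx N α, totalDegree_bernsteinPoly_le hx α.2.1, fun l => ?_, ?_⟩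
    · rw [eval_bernsteinPoly]
      exact bernstein_vertex_of_ne hx α.2.1 (α.2.2 l)
    · simp only [eval_bernsteinPoly]
      rfl
  | zero =>
    refine ⟨0, by simp, by simp, ?_⟩
    ext y j
    rw [grad_eval]
    simp
  | add u v _ _ hu hv =>
    obtain ⟨p, hp, hp0, rfl⟩ := hu
    obtain ⟨q, hq, hq0, rfl⟩ := hv
    refine ⟨p + q, (totalDegree_add _ _).trans (max_le hp hq), by simp [hp0, hq0], ?_⟩
    ext y j
    refine Eq.trans ?_ (grad_eval (p + q) y j).symm
    rw [map_add, map_add, ← grad_eval, ← grad_eval]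
    rfl
  | smul a v _ hv =>
    obtain ⟨p, hp, hp0, rfl⟩ := hv
    refine ⟨a • p, (totalDegree_smul_le _ _).trans hp, by simp [hp0], ?_⟩
    ext y j
    refine Eq.trans ?_ (grad_eval (a • p) y j).symm
    rw [Derivation.map_smul, smul_eval, ← grad_eval]
    rfl

theorem span_gradFamily_mono {m n : ℕ} (h : m ≤ n) :
    Submodule.span ℝ (Set.range (gradFamily hx m)) ≤
      Submodule.span ℝ (Set.range (gradFamily hx n)) := by
  intro v hv
  obtain ⟨p, hp, hp0, rfl⟩ := exists_of_mem_span_gradFamily hx hv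
  exact grad_mem_span_gradFamily hx (hp.trans h) hp0

/-- A gradient of first kind has a potential of degree at most `n + 1`. -/
theorem mem_span_gradFamily_of_mem_nedelecOne {n N : ℕ} {v : tetra x → R3}
    (hv : v ∈ Submodule.span ℝ (Set.range (gradFamily hx N)))
    (hv' : v ∈ nedelecOne (tetra x) n) :
    v ∈ Submodule.span ℝ (Set.range (gradFamily hx (n + 1))) := by
  obtain ⟨p, -, hp0, rfl⟩ := exists_of_mem_span_gradFamily hx hv
  refine grad_mem_span_gradFamily hx ?_ hp0
  obtain ⟨q, hq, hqv⟩ := exists_dotProduct_of_mem_nedelecOne hv'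
  -- Euler's operator scales the coefficient at `d` by `|d|`, which is nonzero for `|d| > n + 1`;
  -- the degree bound on `q` therefore passes to `p`.
  have h1 : ∑ j, X j * pderiv j p = q := polyEval_injective hx <| by
    ext y
    refine Eq.trans ?_ (hqv y)
    simp [polyEval, grad_eval]
  rw [totalDegree, Finset.sup_le_iff]
  intro d hd
  by_contra! hlt
  rw [Finsupp.sum_fintype _ _ (by simp)] at hlt
  have h2 := coeff_sum_X_mul_pderiv p d
  rw [h1, coeff_eq_zero_of_totalDegree_lt] at h2
  · rcases mul_eq_zero.1 h2.symm with h3 | h3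
    · have : ∑ j, d j = 0 := by exact_mod_cast h3
      omega
    · exact mem_support_iff.1 hd h3
  · refine lt_of_le_of_lt hq ?_
    refine lt_of_lt_of_eq hlt ?_
    symm
    exact Finset.sum_subset (Finset.subset_univ _) fun j _ hj => by simpa using hj

/-! ### The first-kind basis -/

/-- In degree one all four indices are vertex indices, so the family is empty. Otherwise it is part
of a second-kind family, for which any admissible `σ` and `r` will do. -/
theorem linearIndependent_gradFamily (n : ℕ) : LinearIndependent ℝ (gradFamily hx (n + 1)) := by
  cases n with
  | zero =>
    have h1 := card_nonVertexIndexSet 1 (by omega)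
    have h2 := card_indexFinset 1
    have : IsEmpty (nonVertexIndexSet (0 + 1)) :=
      Fintype.card_eq_zero_iff.1 (by rw [zero_add]; omega)
    exact linearIndependent_empty_type
  | succ k =>
    have hli := linearIndependent_curlFamily hx
      (σ := fun m => Equiv.swap 3 m) (by simp) k (r := fun m => k • unitIndex (m + 1)) (by
        intro m
        refine ⟨by simp [indexSet, ← Finset.mul_sum], ?_⟩
        have : m + 1 ≠ m := by revert m; decide
        simp [this.symm])
    exact hli.comp (fun α => .inr (.inl α)) (fun α β h => by simpa using h)

/-- The span of a family on a sum of two index types. -/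
theorem span_range_sum {ι κ V : Type*} [AddCommGroup V] [Module ℝ V] (v : ι ⊕ κ → V) :
    Submodule.span ℝ (Set.range v) = Submodule.span ℝ (Set.range fun i => v (.inl i)) ⊔
      Submodule.span ℝ (Set.range fun i => v (.inr i)) := by
  rw [← Submodule.span_union]
  congr 1
  ext u
  simp

/-- Replacing the middle part of a linearly independent family by an independent family in its
span preserves linear independence. -/
theorem linearIndependent_of_replace_middle {ι κ κ' μ V : Type*} [AddCommGroup V] [Module ℝ V]
    {v : ι ⊕ κ ⊕ μ → V} {v' : ι ⊕ κ' ⊕ μ → V} (hv : LinearIndependent ℝ v)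
    (h1 : ∀ i, v' (.inl i) = v (.inl i)) (h3 : ∀ i, v' (.inr (.inr i)) = v (.inr (.inr i)))
    (h2 : LinearIndependent ℝ fun i => v' (.inr (.inl i)))
    (hspan : Submodule.span ℝ (Set.range fun i => v' (.inr (.inl i))) ≤
      Submodule.span ℝ (Set.range fun i => v (.inr (.inl i)))) :
    LinearIndependent ℝ v' := by
  rw [linearIndependent_sum, linearIndependent_sum] at hv ⊢
  have e1 : v' ∘ Sum.inl = v ∘ Sum.inl := funext h1
  have e3 : (v' ∘ Sum.inr) ∘ Sum.inr = (v ∘ Sum.inr) ∘ Sum.inr := funext h3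
  obtain ⟨ha, ⟨-, hd, hbd⟩, habd⟩ := hv
  refine ⟨e1 ▸ ha, ⟨h2, e3 ▸ hd, ?_⟩, ?_⟩
  · rw [e3]
    exact hbd.mono_left hspan
  · rw [e1]
    refine habd.mono_right ?_
    rw [span_range_sum (v' ∘ Sum.inr), span_range_sum (v ∘ Sum.inr)]
    exact sup_le_sup hspan (le_of_eq (congrArg (fun w => Submodule.span ℝ (Set.range w)) e3))

theorem isBasisOf_nedelecOne {σ : Fin 4 → Equiv.Perm (Fin 4)} (hσ : ∀ m, σ m 3 = m)
    (n : ℕ) {r : Fin 4 → MultiIndex} (hr : ∀ m, r m ∈ faceIndexSet m n) :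
    IsBasisOf (curlFamily x hx σ n n r) (nedelecOne (tetra x) n) := by
  obtain ⟨hli, hsp⟩ := isBasisOf_nedelecTwo hx hσ n hr
  have hmem1 : ∀ e, curlFamily x hx σ n n r (.inl e) ∈ nedelecOne (tetra x) n := fun e => by
    have := smul_whitney_mem_nedelecOne hx (n := n) (q := 1) (by simp) e.1.1 e.1.2
    simp only [map_one, one_smul] at this
    exact this
  have hmem3 : ∀ i, curlFamily x hx σ n n r (.inr (.inr i)) ∈ nedelecOne (tetra x) n := by
    rintro (f | c)
    · exact faceBubble_mem_nedelecOne hx f.2.2.1.1 _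
    · exact cellBubble_mem_nedelecOne hx c.2.1 _
  refine ⟨linearIndependent_of_replace_middle hli (fun _ => rfl)
    (by rintro (_ | _) <;> rfl)
    (linearIndependent_gradFamily hx n) (span_gradFamily_mono hx (n + 1).le_succ),
    le_antisymm ?_ ?_⟩
  · rw [Submodule.span_le]
    rintro _ ⟨e | α | i, rfl⟩
    · exact hmem1 e
    · refine Submodule.mem_sup_left ?_
      have := arrayFieldOn_mem hx n fun β l => if α.1 = β + unitIndex l then (n : ℝ) + 1 else 0
      convert this using 1
      ext1 y
      exact congrFun (grad_bernstein hx α.2.1) y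
    · exact hmem3 i
  · intro v hv
    have hv2 := nedelecOne_le_nedelecTwo _ _ hv
    rw [← hsp, span_range_sum] at hv2
    obtain ⟨a, ha, w, hw, rfl⟩ := Submodule.mem_sup.1 hv2
    rw [span_range_sum] at hw
    obtain ⟨b, hb, d, hd, rfl⟩ := Submodule.mem_sup.1 hw
    have ha' : a ∈ nedelecOne (tetra x) n :=
      Submodule.span_le.2 (by rintro _ ⟨e, rfl⟩; exact hmem1 e) ha
    have hd' : d ∈ nedelecOne (tetra x) n :=
      Submodule.span_le.2 (by rintro _ ⟨f | c, rfl⟩; exacts [hmem3 (.inl f), hmem3 (.inr c)]) hd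
    -- The gradient part is the given field minus its Whitney and bubble parts, all of which are of
    -- the first kind.
    have hb' : b ∈ nedelecOne (tetra x) n := by
      have := Submodule.sub_mem _ (Submodule.sub_mem _ hv ha') hd'
      rwa [add_sub_cancel_left, add_sub_cancel_right] at this
    have hfun : (fun i => curlFamily x hx σ (n + 1) n r (.inr (.inr i))) =
        fun i => curlFamily x hx σ n n r (.inr (.inr i)) := by
      funext i
      rcases i with _ | _ <;> rfl
    rw [span_range_sum, span_range_sum fun i => curlFamily x hx σ n n r (.inr i)]
    exact Submodule.add_mem_sup ha (Submodule.add_mem_sup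
      (mem_span_gradFamily_of_mem_nedelecOne hx hb hb') (hfun ▸ hd))

end BernsteinCurl

end

theorem theorem3p3 (x : Fin 4 → BernsteinCurl.R3) (hx : AffineIndependent ℝ x)
    (σ : Fin 4 → Equiv.Perm (Fin 4)) (hσ : ∀ m, σ m 3 = m) :
    (∀ n : ℕ,
      Disjoint (BernsteinCurl.nedelecTwo (BernsteinCurl.tetra x) n)
        (BernsteinCurl.crossHom (BernsteinCurl.tetra x) n) ∧
      ∀ r : Fin 4 → BernsteinCurl.MultiIndex, (∀ m, r m ∈ BernsteinCurl.faceIndexSet m n) →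
        BernsteinCurl.IsBasisOf (BernsteinCurl.curlFamily x hx σ n n r)
          (BernsteinCurl.nedelecOne (BernsteinCurl.tetra x) n)) ∧
    (∀ n : ℕ, 1 ≤ n →
      ∀ r : Fin 4 → BernsteinCurl.MultiIndex, (∀ m, r m ∈ BernsteinCurl.faceIndexSet m (n - 1)) →
        BernsteinCurl.IsBasisOf (BernsteinCurl.curlFamily x hx σ n (n - 1) r)
          (BernsteinCurl.nedelecTwo (BernsteinCurl.tetra x) n)) := by
  refine ⟨fun n => ⟨BernsteinCurl.disjoint_nedelecTwo_crossHom hx n,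
    fun r hr => BernsteinCurl.isBasisOf_nedelecOne hx hσ n hr⟩, fun n hn r hr => ?_⟩
  obtain ⟨k, rfl⟩ : ∃ k, n = k + 1 := ⟨n - 1, by omega⟩
  exact BernsteinCurl.isBasisOf_nedelecTwo hx hσ k hr
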